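/- **Model.** A cell-free system has $L$ access points (APs) with $M$ antennas each, $K\ge 1$ single-antenna users and a single-antenna eavesdropper $E$ attacking user $1$. The channels are $\mathbf h_{l,k}=\sqrt{\beta_{l,k}}\,\mathbf g_{l,k}$ and $\mathbf h_{l,E}=\sqrt{\beta_{l,E}}\,\mathbf g_{l,E}$ with $\beta_{l,k}>0$, $\beta_{l,E}\ge 0$. AP $l$ receives the pilot matrix $$\mathbf Y_l=\sqrt{\tau_p\rho_u}\sum_{k=1}^K\mathbf h_{l,k}\boldsymbol\phi_k^{\mathrm H}+\sqrt{\tau_p\rho_E}\,\mathbf h_{l,E}\boldsymbol\phi_1^{\mathrm H}+\mathbf N_l ,$$ where $\boldsymbol\phi_1,\dots,\boldsymbol\phi_K\in\mathbb C^{\tau_p}$ are orthonormal, $\rho_u>0$, $\rho_E\ge 0$, and all entries of all $\mathbf g_{l,k},\mathbf g_{l,E},\mathbf N_l$ are i.i.d. $\mathcal{CN}(0,1)$. Put $v_{l,k}=\tau_p\rho_u\beta_{l,k}+1$ for $k\ne 1$ and $v_{l,1}=\tau_p\rho_u\beta_{l,1}+\tau_p\rho_E\beta_{l,E}+1$. The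 channel estimates are $\hat{\mathbf h}_{l,k}=\frac{\sqrt{\tau_p\rho_u}\,\beta_{l,k}}{v_{l,k}}\mathbf Y_l\boldsymbol\phi_k$; put $\gamma_{l,k}=\tau_p\rho_u\beta_{l,k}^2/v_{l,k}$ and $\gamma_{l,E}=\frac{\rho_E\beta_{l,E}^2}{\rho_u\beta_{l,1}^2}\gamma_{l,1}$. Each AP $l$ has a fixed set $\mathcal S_l\subseteq\{1,\dots,K\}$ of strong users with $|\mathcal S_l|<M$. Let $\hat{\mathbf H}_{\mathcal S_l}$ be the matrix with columns $\hat{\mathbf h}_{l,i}$, $i\in\mathcal S_l$. The protective partial zero-forcing (PPZF) precoder is $\mathbf w_{l,k}=\mathbf v_{l,k}/\sqrt{\mathbb E\|\mathbf v_{l,k}\|^2}$, where for $k\in\mathcal S_l$ the vector $\mathbf v_{l,k}$ is the column of $\hat{\mathbf H}_{\mathcal S_l}(\hat{\mathbf H}_{\mathcal S_l}^{\mathrm H}\hat{\mathbf H}_{\mathcal S_l})^{-1}$ belonging to $k$, and for $k\notin\mathcal S_l$, $\mathbf v_{l,k}=\big(\mathbf I_M-\hat{\mathbf H}_{\mathcal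 S_l}(\hat{\mathbf H}_{\mathcal S_l}^{\mathrm H}\hat{\mathbf H}_{\mathcal S_l})^{-1}\hat{\mathbf H}_{\mathcal S_l}^{\mathrm H}\big)\hat{\mathbf h}_{l,k}$. AP $l$ transmits $\mathbf x_l=\sum_k\sqrt{\rho_{l,k}}\,\mathbf w_{l,k}s_k$ with $\rho_{l,k}\ge 0$, and the eavesdropper receives $z_E=\sum_l\mathbf h_{l,E}^{\mathrm H}\mathbf x_l+n_E$ with noise of unit power. Put $\mathrm{BU}_{E,1}=\sum_l\sqrt{\rho_{l,1}}\,\mathbf h_{l,E}^{\mathrm H}\mathbf w_{l,1}$ and $\mathrm{UI}_{E,t}=\sum_l\sqrt{\rho_{l,t}}\,\mathbf h_{l,E}^{\mathrm H}\mathbf w_{l,t}$ for $t\ne 1$. Let $X=|\mathrm{BU}_{E,1}|^2$ and $Y=\sum_{t\ne1}|\mathrm{UI}_{E,t}|^2+1$. The spectral efficiency (SE) of the eavesdropper with perfect channel knowledge is $R_E=\mathbb E\{\log_2(1+X/Y)\}$. Put $\mathcal Z_1=\{l:1\in\mathcal S_l\}$, and $\delta_{l,1}=1$ if $1\in\mathcal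 S_l$, $\delta_{l,1}=0$ otherwise. **Proposition 2.** One has $z_E=\mathrm{BU}_{E,1}s_1+\sum_{t\neq1}\mathrm{UI}_{E,t}s_t+n_E$. The variables $|\mathrm{BU}_{E,1}|^2$ and $|\mathrm{UI}_{E,t}|^2$ are integrable, with $$\mathbb E|\mathrm{BU}_{E,1}|^2=\Big(\sum_{l}\sqrt{\rho_{l,1}(M-|\mathcal S_l|)\gamma_{l,E}}\Big)^2+\sum_l\rho_{l,1}\beta_{l,E}-\sum_{l\in\mathcal Z_1}\rho_{l,1}\gamma_{l,E},$$ $$\mathbb E|\mathrm{UI}_{E,t}|^2=\sum_l\rho_{l,t}(\beta_{l,E}-\delta_{l,1}\gamma_{l,E})\qquad(t\ne1).$$ Consequently the approximation of $R_E$ obtained by replacing $X$ and $Y$ by their means is $$\log_2\Big(1+\frac{\mathbb E|\mathrm{BU}_{E,1}|^2}{\sum_{t\ne1}\mathbb E|\mathrm{UI}_{E,t}|^2+1}\Big)=\log_2(1+\mathrm{SINR}_E),$$ $$\mathrm{SINR}_E=\frac{\big(\sum_{l}\sqrt{\rho_{l,1}(M-|\mathcal S_l|)\gamma_{l,E}}\big)^2+\sum_l\rho_{l,1}\beta_{l,E}-\sum_{l\in\mathcal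 Z_1}\rho_{l,1}\gamma_{l,E}}{\sum_{t\ne1}\sum_l\rho_{l,t}(\beta_{l,E}-\delta_{l,1}\gamma_{l,E})+1}.$$ Moreover $\log_2(1+X/Y)$ is integrable, and $R_E\approx\log_2(1+\mathrm{SINR}_E)$ in the sense that $$\big|R_E-\log_2(1+\mathrm{SINR}_E)\big|\le\frac{1}{\ln 2}\max\{D(X+Y),D(Y)\},\qquad D(Z)=\mathbb E\Big\{\frac{(Z-\mathbb E Z)^2}{Z\,\mathbb E Z}\Big\}.$$ -/

import Mathlib

open MeasureTheory ProbabilityTheory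

noncomputable section

namespace CellFree

/-- The circularly symmetric complex Gaussian law `CN(0, v)`: real and imaginary parts are
independent centred real Gaussians of variance `v / 2`. -/
def complexGaussian (v : NNReal) : Measure ℂ :=
  ((gaussianReal 0 (v / 2)).prod (gaussianReal 0 (v / 2))).map
    (fun p : ℝ × ℝ => (⟨p.1, p.2⟩ : ℂ))

/-- Squared Euclidean norm of a complex vector. -/
def sqNorm {M : ℕ} (v : Fin M → ℂ) : ℝ := ∑ m, ‖v m‖ ^ 2

/-- Deterministic parameters of the system: `L` access points (APs) with `M` antennas each,
`K` single-antenna users, and pilots of length `τ`. User `0 : Fin K` is the attacked user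
(user 1 in the usual numbering). -/
structure Params (L K M τ : ℕ) where
  /-- large-scale fading between an AP and a user -/
  β : Fin L → Fin K → ℝ
  /-- large-scale fading between an AP and the eavesdropper -/
  βE : Fin L → ℝ
  /-- uplink pilot SNR of the users -/
  ρu : ℝ
  /-- uplink pilot SNR of the eavesdropper -/
  ρE : ℝ
  /-- downlink power control coefficients -/
  ρ : Fin L → Fin K → ℝ
  /-- pilot sequences -/
  φ : Fin K → Fin τ → ℂ
  /-- strong users of an AP; the weak users are the remaining ones -/
  S : Fin L → Finset (Fin K)

/-- Standing assumptions on the parameters: positive fading and pilot SNR, nonnegative powers,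
orthonormal pilots, and more antennas than strong users at every AP. -/
structure Params.Admissible {L K M τ : ℕ} (p : Params L K M τ) : Prop where
  β_pos : ∀ l k, 0 < p.β l k
  βE_nonneg : ∀ l, 0 ≤ p.βE l
  ρu_pos : 0 < p.ρu
  ρE_nonneg : 0 ≤ p.ρE
  ρ_nonneg : ∀ l k, 0 ≤ p.ρ l k
  pilots : ∀ k k', star (p.φ k) ⬝ᵥ p.φ k' = if k = k' then 1 else 0
  card_lt : ∀ l, (p.S l).card < M

/-- The random quantities: small-scale fading to the users, small-scale fading to the
eavesdropper, and the noise received by each AP during uplink training. -/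
structure Randomness (Ω : Type*) (L K M τ : ℕ) where
  g : Fin L → Fin K → Fin M → Ω → ℂ
  gE : Fin L → Fin M → Ω → ℂ
  N : Fin L → Fin M → Fin τ → Ω → ℂ

/-- All scalar random entries, as one family. -/
def Randomness.entries {Ω : Type*} {L K M τ : ℕ} (r : Randomness Ω L K M τ) :
    (Fin L × Fin K × Fin M) ⊕ (Fin L × Fin M) ⊕ (Fin L × Fin M × Fin τ) → Ω → ℂ :=
  Sum.elim (fun i => r.g i.1 i.2.1 i.2.2)
    (Sum.elim (fun i => r.gE i.1 i.2) (fun i => r.N i.1 i.2.1 i.2.2))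

/-- Independent Rayleigh fading and noise: all entries are i.i.d. `CN(0, 1)`. -/
structure Randomness.IsRayleigh {Ω : Type*} [MeasurableSpace Ω] {L K M τ : ℕ}
    (r : Randomness Ω L K M τ) (P : Measure Ω) : Prop where
  indep : iIndepFun r.entries P
  law : ∀ i, HasLaw (r.entries i) (complexGaussian 1) P

section Model

variable {Ω : Type*} {L K M τ : ℕ}

/-- Channel from AP `l` to user `k`. -/
def h (p : Params L K M τ) (r : Randomness Ω L K M τ) (l : Fin L) (k : Fin K) (ω : Ω) :
    Fin M → ℂ :=
  fun m => (Real.sqrt (p.β l k) : ℂ) * r.g l k m ω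

/-- Channel from AP `l` to the eavesdropper. -/
def hE (p : Params L K M τ) (r : Randomness Ω L K M τ) (l : Fin L) (ω : Ω) : Fin M → ℂ :=
  fun m => (Real.sqrt (p.βE l) : ℂ) * r.gE l m ω

/-- Received pilot matrix at AP `l`; the eavesdropper sends the pilot of user `0`. -/
def pilotMatrix [NeZero K] (p : Params L K M τ) (r : Randomness Ω L K M τ) (l : Fin L) (ω : Ω) :
    Matrix (Fin M) (Fin τ) ℂ :=
  (Real.sqrt (τ * p.ρu) : ℂ) • ∑ k, Matrix.vecMulVec (h p r l k ω) (star (p.φ k))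
    + (Real.sqrt (τ * p.ρE) : ℂ) • Matrix.vecMulVec (hE p r l ω) (star (p.φ 0))
    + Matrix.of fun m j => r.N l m j ω

/-- The variance `τ ρu β + 1` (plus `τ ρE βE` for the attacked user) of the entries of the
projected pilot signal. -/
def pilotVar [NeZero K] (p : Params L K M τ) (l : Fin L) (k : Fin K) : ℝ :=
  if k = 0 then τ * p.ρu * p.β l k + τ * p.ρE * p.βE l + 1 else τ * p.ρu * p.β l k + 1

/-- The MMSE channel estimate of `h l k`, computed from the projected pilot signal. -/
def hhat [NeZero K] (p : Params L K M τ) (r : Randomness Ω L K M τ) (l : Fin L) (k : Fin K)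
    (ω : Ω) : Fin M → ℂ :=
  ((Real.sqrt (τ * p.ρu) * p.β l k / pilotVar p l k : ℝ) : ℂ) •
    (pilotMatrix p r l ω).mulVec (p.φ k)

/-- Variance of the channel estimate to user `k`. -/
def γ [NeZero K] (p : Params L K M τ) (l : Fin L) (k : Fin K) : ℝ :=
  τ * p.ρu * p.β l k ^ 2 / pilotVar p l k

/-- `γ_{l,E} = α_{l,1} γ_{l,1}` with `α_{l,1} = ρE βE² / (ρu β_{l,1}²)`. -/
def γE [NeZero K] (p : Params L K M τ) (l : Fin L) : ℝ :=
  p.ρE * p.βE l ^ 2 / (p.ρu * p.β l 0 ^ 2) * γ p l 0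

/-- The collective channel estimate `Ĥ_l`, an `M × K` matrix. -/
def Hhat [NeZero K] (p : Params L K M τ) (r : Randomness Ω L K M τ) (l : Fin L) (ω : Ω) :
    Matrix (Fin M) (Fin K) ℂ :=
  Matrix.of fun m k => hhat p r l k ω m

/-- The selection matrix of the columns of the strong users of AP `l`. -/
def selS (p : Params L K M τ) (l : Fin L) : Matrix (Fin K) (p.S l) ℂ :=
  Matrix.of fun k i => if k = i then 1 else 0

/-- `Ĥ_l E_S`: the estimates of the strong users of AP `l`. -/
def HS [NeZero K] (p : Params L K M τ) (r : Randomness Ω L K M τ) (l : Fin L) (ω : Ω) :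
    Matrix (Fin M) (p.S l) ℂ :=
  Hhat p r l ω * selS p l

/-- `Ĥ_l E_S (E_Sᴴ Ĥ_lᴴ Ĥ_l E_S)⁻¹`. -/
def pinvS [NeZero K] (p : Params L K M τ) (r : Randomness Ω L K M τ) (l : Fin L) (ω : Ω) :
    Matrix (Fin M) (p.S l) ℂ :=
  HS p r l ω * ((HS p r l ω).conjTranspose * HS p r l ω)⁻¹

/-- Unnormalized partial zero-forcing vector; only used for `k ∈ S l`. -/
def vPZF [NeZero K] (p : Params L K M τ) (r : Randomness Ω L K M τ) (l : Fin L) (k : Fin K)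
    (ω : Ω) : Fin M → ℂ :=
  (pinvS p r l ω).mulVec fun i => if (i : Fin K) = k then 1 else 0

/-- The projection `B_l` onto the orthogonal complement of the strong users' estimates. -/
def projB [NeZero K] (p : Params L K M τ) (r : Randomness Ω L K M τ) (l : Fin L) (ω : Ω) :
    Matrix (Fin M) (Fin M) ℂ :=
  1 - pinvS p r l ω * (HS p r l ω).conjTranspose

/-- Unnormalized protective maximum-ratio vector; only used for `k ∉ S l`. -/
def vPMRT [NeZero K] (p : Params L K M τ) (r : Randomness Ω L K M τ) (l : Fin L) (k : Fin K)
    (ω : Ω) : Fin M → ℂ :=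
  (projB p r l ω).mulVec (hhat p r l k ω)

/-- A random vector divided by the root of its mean squared norm. -/
def normalize [MeasurableSpace Ω] (P : Measure Ω) (v : Ω → Fin M → ℂ) (ω : Ω) : Fin M → ℂ :=
  (((Real.sqrt (∫ ω', sqNorm (v ω') ∂P))⁻¹ : ℝ) : ℂ) • v ω

/-- The protective partial zero-forcing precoder of AP `l` towards user `k`. -/
def w [NeZero K] [MeasurableSpace Ω] (P : Measure Ω) (p : Params L K M τ)
    (r : Randomness Ω L K M τ) (l : Fin L) (k : Fin K) : Ω → Fin M → ℂ :=
  if k ∈ p.S l then normalize P (vPZF p r l k) else normalize P (vPMRT p r l k)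

/-- Signal transmitted by AP `l` when the data symbols are `s`. -/
def transmit [NeZero K] [MeasurableSpace Ω] (P : Measure Ω) (p : Params L K M τ)
    (r : Randomness Ω L K M τ) (s : Fin K → ℂ) (l : Fin L) (ω : Ω) : Fin M → ℂ :=
  ∑ k, ((Real.sqrt (p.ρ l k) : ℂ) * s k) • w P p r l k ω

/-- Signal received by the eavesdropper for data symbols `s` and noise value `n`. -/
def zE [NeZero K] [MeasurableSpace Ω] (P : Measure Ω) (p : Params L K M τ)
    (r : Randomness Ω L K M τ) (s : Fin K → ℂ) (n : ℂ) (ω : Ω) : ℂ :=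
  ∑ l, star (hE p r l ω) ⬝ᵥ transmit P p r s l ω + n

/-- Effective channel at the eavesdropper of the symbol of user `t`: the desired gain
`BU_{E,1}` for the attacked user, and the interference gain `UI_{E,t}` for the others. -/
def gainE [NeZero K] [MeasurableSpace Ω] (P : Measure Ω) (p : Params L K M τ)
    (r : Randomness Ω L K M τ) (t : Fin K) (ω : Ω) : ℂ :=
  ∑ l, (Real.sqrt (p.ρ l t) : ℂ) * (star (hE p r l ω) ⬝ᵥ w P p r l t ω)

/-- Instantaneous power `|BU_{E,1}|²` of the desired signal at the eavesdropper. -/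
def signalE [NeZero K] [MeasurableSpace Ω] (P : Measure Ω) (p : Params L K M τ)
    (r : Randomness Ω L K M τ) (ω : Ω) : ℝ :=
  ‖gainE P p r 0 ω‖ ^ 2

/-- Instantaneous interference-plus-noise power `∑_{t ≠ 1} |UI_{E,t}|² + 1` at the
eavesdropper. -/
def interfE [NeZero K] [MeasurableSpace Ω] (P : Measure Ω) (p : Params L K M τ)
    (r : Randomness Ω L K M τ) (ω : Ω) : ℝ :=
  ∑ t with t ≠ 0, ‖gainE P p r t ω‖ ^ 2 + 1

/-- Instantaneous rate of the eavesdropper with perfect CSI, interference treated as noise. -/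
def instRateE [NeZero K] [MeasurableSpace Ω] (P : Measure Ω) (p : Params L K M τ)
    (r : Randomness Ω L K M τ) (ω : Ω) : ℝ :=
  Real.logb 2 (1 + signalE P p r ω / interfE P p r ω)

/-- Spectral efficiency of the eavesdropper with perfect CSI. -/
def rateE [NeZero K] [MeasurableSpace Ω] (P : Measure Ω) (p : Params L K M τ)
    (r : Randomness Ω L K M τ) : ℝ :=
  ∫ ω, instRateE P p r ω ∂P

/-- The approximation of `rateE` in which signal and interference powers are replaced by
their means. -/
def approxRateE [NeZero K] [MeasurableSpace Ω] (P : Measure Ω) (p : Params L K M τ)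
    (r : Randomness Ω L K M τ) : ℝ :=
  Real.logb 2 (1 + (∫ ω, ‖gainE P p r 0 ω‖ ^ 2 ∂P) /
    (∑ t with t ≠ 0, ∫ ω, ‖gainE P p r t ω‖ ^ 2 ∂P + 1))

/-- Relative dispersion `E[(Z - E Z)² / (Z · E Z)]` of a positive random variable around its
mean. -/
def dispersion [MeasurableSpace Ω] (P : Measure Ω) (Z : Ω → ℝ) : ℝ :=
  ∫ ω, (Z ω - ∫ ω', Z ω' ∂P) ^ 2 / (Z ω * ∫ ω', Z ω' ∂P) ∂P

/-- The APs that serve user `k` by partial zero-forcing. -/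
def servedPZF (p : Params L K M τ) (k : Fin K) : Finset (Fin L) := {l | k ∈ p.S l}

/-- `δ_{l,k}`: one if `k` is a strong user of AP `l`, zero otherwise. -/
def δ (p : Params L K M τ) (l : Fin L) (k : Fin K) : ℝ := if k ∈ p.S l then 1 else 0

/-- Numerator of the closed-form SINR of the eavesdropper. -/
def sinrENum [NeZero K] (p : Params L K M τ) : ℝ :=
  (∑ l, Real.sqrt (p.ρ l 0 * ((M : ℝ) - (p.S l).card) * γE p l)) ^ 2
    + ∑ l, p.ρ l 0 * p.βE l - ∑ l ∈ servedPZF p 0, p.ρ l 0 * γE p l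

/-- The closed-form SINR of the eavesdropper. -/
def sinrE [NeZero K] (p : Params L K M τ) : ℝ :=
  sinrENum p /
    (∑ t with t ≠ 0, ∑ l, p.ρ l t * (p.βE l - δ p l 0 * γE p l) + 1)

end Model

end CellFree

end

/- Pilot contamination makes the eavesdropper's channel correlated with the estimate of the channel
of the attacked user `0`, and with nothing else that the precoders see. At every AP, a matrix with
orthonormal rows turns the i.i.d. entries into independent standard Gaussian vectors `z k`, one for
each user, and a further one `e`, such that the estimates are `√γ_k • z k` and the eavesdropper's
channel is `√γ_E • z 0 + √(β_E - γ_E) • e`. The precoders are normalized functions of the `z k` and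
do not depend on the scales `√γ_k`. Zero-forcing makes `⟨z 0, w t⟩` deterministic when `0` is a
strong user. When `0` is a weak user, the gain towards `t = 0` is a multiple of the squared norm of
a projection of `z 0`, which is Gamma distributed, and the gains towards `t ≠ 0` are conditionally
centred. The part along `e` is centred and independent of the precoder, hence adds `β_E - γ_E`. The
APs are independent, so that the second moment of the total gain is the square of the sum of the
means plus the sum of the variances.

The error bound comes from `log (1 + X / Y) = log (X + Y) - log Y`: for `Z ≥ 1`, the Jensen gap
`log (E Z) - E (log Z)` is at most `E Z * E (1 / Z) - 1`, by `log x ≤ x - 1` at `x = E Z / Z`, and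
this bound is the dispersion of `Z`. -/

noncomputable section

namespace CellFree

open MeasureTheory ProbabilityTheory Filter
open scoped NNReal ENNReal Topology Matrix ComplexConjugate

section GammaLaw

variable {a r : ℝ}

lemma integral_gammaMeasure (ha : 0 < a) (hr : 0 < r) (f : ℝ → ℝ) :
    ∫ x, f x ∂gammaMeasure a r =
      ∫ x in Set.Ioi 0, r ^ a / Real.Gamma a * (x ^ (a - 1) * Real.exp (-(r * x)) * f x) := by
  have hdens (x : ℝ) : (gammaPDF a r x).toReal • f x =
      (Set.Ici 0).indicator
        (fun x => r ^ a / Real.Gamma a * (x ^ (a - 1) * Real.exp (-(r * x)) * f x)) x := by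
    rw [gammaPDF, ENNReal.toReal_ofReal (gammaPDFReal_nonneg ha hr x), gammaPDFReal,
      Set.indicator_apply, smul_eq_mul]
    simp only [Set.mem_Ici]
    split_ifs <;> ring
  have hmeas : Measurable (gammaPDF a r) := (measurable_gammaPDFReal a r).ennreal_ofReal
  rw [gammaMeasure, integral_withDensity_eq_integral_toReal_smul hmeas
    (.of_forall fun x => ENNReal.ofReal_lt_top)]
  simp_rw [hdens]
  rw [integral_indicator measurableSet_Ici, integral_Ici_eq_integral_Ioi]

lemma integral_rpow_gammaMeasure {s : ℝ} (ha : 0 < a) (hr : 0 < r) (hs : 0 < a + s) :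
    ∫ x, x ^ s ∂gammaMeasure a r = Real.Gamma (a + s) / (Real.Gamma a * r ^ s) := by
  have hpow : ∀ x ∈ Set.Ioi (0 : ℝ), x ^ (a - 1) * Real.exp (-(r * x)) * x ^ s =
      x ^ (a + s - 1) * Real.exp (-(r * x)) := fun x hx => by
    rw [mul_right_comm, ← Real.rpow_add hx]
    ring_nf
  rw [integral_gammaMeasure ha hr, integral_const_mul, setIntegral_congr_fun measurableSet_Ioi hpow,
    Real.integral_rpow_mul_exp_neg_mul_Ioi hs hr, Real.div_rpow zero_le_one hr.le,
    Real.one_rpow, Real.rpow_add hr]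
  have := (Real.rpow_pos_of_pos hr a).ne'
  have := (Real.rpow_pos_of_pos hr s).ne'
  field_simp

lemma integrable_rpow_gammaMeasure {s : ℝ} (ha : 0 < a) (hr : 0 < r) (hs : 0 < a + s) :
    Integrable (fun x => x ^ s) (gammaMeasure a r) := by
  have hpos : 0 < ∫ x, x ^ s ∂gammaMeasure a r := by
    rw [integral_rpow_gammaMeasure ha hr hs]
    have := Real.Gamma_pos_of_pos ha
    have := Real.Gamma_pos_of_pos hs
    positivity
  exact Integrable.of_integral_ne_zero hpos.ne'

lemma ae_pos_gammaMeasure (a r : ℝ) : ∀ᵐ x ∂gammaMeasure a r, 0 < x := by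
  have hmeas : Measurable (gammaPDF a r) := (measurable_gammaPDFReal a r).ennreal_ofReal
  rw [gammaMeasure, ae_withDensity_iff hmeas]
  filter_upwards [Measure.ae_ne volume 0] with x hx0 hpdf
  exact lt_of_not_ge fun hx => hpdf (gammaPDF_of_neg (lt_of_le_of_ne hx hx0))

lemma integral_id_gammaMeasure (ha : 0 < a) (hr : 0 < r) : ∫ x, x ∂gammaMeasure a r = a / r := by
  have h := integral_rpow_gammaMeasure (s := 1) ha hr (by linarith)
  have := (Real.Gamma_pos_of_pos ha).ne'
  simp_rw [Real.rpow_one, Real.Gamma_add_one ha.ne'] at h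
  rw [h]
  field_simp

lemma integral_sq_gammaMeasure (ha : 0 < a) (hr : 0 < r) :
    ∫ x, x ^ 2 ∂gammaMeasure a r = a * (a + 1) / r ^ 2 := by
  have h := integral_rpow_gammaMeasure (s := 2) ha hr (by linarith)
  have := (Real.Gamma_pos_of_pos ha).ne'
  rw [← one_add_one_eq_two, ← add_assoc, Real.Gamma_add_one (by linarith),
    Real.Gamma_add_one ha.ne', one_add_one_eq_two] at h
  simp_rw [Real.rpow_two] at h
  rw [h]
  field_simp

lemma integral_inv_gammaMeasure (ha : 1 < a) (hr : 0 < r) :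
    ∫ x, x⁻¹ ∂gammaMeasure a r = r / (a - 1) := by
  have h := integral_rpow_gammaMeasure (s := -1) (zero_lt_one.trans ha) hr (by linarith)
  have ha1 : 0 < a - 1 := by linarith
  have := (Real.Gamma_pos_of_pos ha1).ne'
  have hΓ : Real.Gamma a = (a - 1) * Real.Gamma (a - 1) := by
    rw [← Real.Gamma_add_one ha1.ne', sub_add_cancel]
  simp_rw [Real.rpow_neg_one, ← sub_eq_add_neg, hΓ] at h
  rw [h]
  field_simp

lemma memLp_two_id_gammaMeasure (ha : 0 < a) (hr : 0 < r) :
    MemLp (fun x => x) 2 (gammaMeasure a r) := by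
  rw [memLp_two_iff_integrable_sq (by fun_prop)]
  exact (integrable_rpow_gammaMeasure (s := 2) ha hr (by linarith)).congr
    (.of_forall fun x => Real.rpow_two x)

lemma integrable_inv_gammaMeasure (ha : 1 < a) (hr : 0 < r) :
    Integrable (fun x => x⁻¹) (gammaMeasure a r) :=
  (integrable_rpow_gammaMeasure (s := -1) (zero_lt_one.trans ha) hr (by linarith)).congr
    (.of_forall fun x => Real.rpow_neg_one x)

lemma mgf_id_gammaMeasure (ha : 0 < a) (hr : 0 < r) (t : ℝ) :
    mgf id (gammaMeasure a r) t = if t < r then (r / (r - t)) ^ a else 0 := by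
  have hexp (x : ℝ) : x ^ (a - 1) * Real.exp (-(r * x)) * Real.exp (t * x) =
      x ^ (a - 1) * Real.exp (-((r - t) * x)) := by
    rw [mul_assoc, ← Real.exp_add]
    ring_nf
  simp only [mgf, id]
  rw [integral_gammaMeasure ha hr, integral_const_mul]
  simp_rw [hexp]
  split_ifs with ht
  · have hrt : 0 < r - t := sub_pos.2 ht
    rw [Real.integral_rpow_mul_exp_neg_mul_Ioi ha hrt, Real.div_rpow zero_le_one hrt.le,
      Real.one_rpow, Real.div_rpow hr.le hrt.le]
    have := (Real.Gamma_pos_of_pos ha).ne'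
    field_simp
  · refine mul_eq_zero_of_right _ (integral_undef fun hint => ?_)
    refine not_integrableOn_Ioi_rpow (a - 1) (hint.mono' (by fun_prop) ?_)
    filter_upwards [ae_restrict_mem measurableSet_Ioi] with x hx
    have hx0 : (0 : ℝ) < x := hx
    rw [Real.norm_of_nonneg (by positivity)]
    refine le_mul_of_one_le_right (by positivity) (Real.one_le_exp ?_)
    nlinarith

lemma ext_of_mgf_id_eq {μ ν : Measure ℝ} [IsProbabilityMeasure μ] [IsProbabilityMeasure ν]
    (h0 : 0 ∈ interior (integrableExpSet id μ)) (h : mgf id μ = mgf id ν) : μ = ν := by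
  refine Measure.ext_of_charFun (funext fun t => ?_)
  rw [← complexMGF_id_mul_I, ← complexMGF_id_mul_I]
  exact eqOn_complexMGF_of_mgf h (by simpa using h0)

end GammaLaw

section ComplexGaussian

lemma measurable_complex_mk : Measurable fun p : ℝ × ℝ => (⟨p.1, p.2⟩ : ℂ) :=
  Complex.measurableEquivRealProd.symm.measurable

instance isProbabilityMeasure_complexGaussian (v : ℝ≥0) :
    IsProbabilityMeasure (complexGaussian v) :=
  Measure.isProbabilityMeasure_map measurable_complex_mk.aemeasurable

lemma integral_complexGaussian {E : Type*} [NormedAddCommGroup E] [NormedSpace ℝ E] (v : ℝ≥0)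
    {f : ℂ → E} (hf : AEStronglyMeasurable f (complexGaussian v)) :
    ∫ z, f z ∂complexGaussian v =
      ∫ q : ℝ × ℝ, f ⟨q.1, q.2⟩ ∂(gaussianReal 0 (v / 2)).prod (gaussianReal 0 (v / 2)) :=
  integral_map measurable_complex_mk.aemeasurable hf

lemma charFun_complexGaussian (v : ℝ≥0) (t : ℂ) :
    charFun (complexGaussian v) t = Complex.exp (-(v * ‖t‖ ^ 2 / 4 : ℝ)) := by
  have hsplit (q : ℝ × ℝ) : Complex.exp ((inner ℝ (⟨q.1, q.2⟩ : ℂ) t : ℝ) * Complex.I) =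
      Complex.exp (t.re * q.1 * Complex.I) * Complex.exp (t.im * q.2 * Complex.I) := by
    rw [← Complex.exp_add, Complex.inner]
    simp only [Complex.mul_re, Complex.conj_re, Complex.conj_im]
    push_cast
    ring_nf
  rw [charFun_apply, integral_complexGaussian v (by fun_prop)]
  simp_rw [hsplit]
  rw [integral_prod_mul (fun x : ℝ => Complex.exp (t.re * x * Complex.I))
    fun y : ℝ => Complex.exp (t.im * y * Complex.I), ← charFun_apply_real, ← charFun_apply_real,
    charFun_gaussianReal, charFun_gaussianReal, ← Complex.exp_add, ← Complex.normSq_eq_norm_sq,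
    Complex.normSq_apply]
  push_cast
  ring_nf

lemma mgf_sq_gaussianReal (v : ℝ≥0) (t : ℝ) :
    mgf (fun x => x ^ 2) (gaussianReal 0 v) t = (√(1 - 2 * v * t))⁻¹ := by
  rcases eq_or_ne v 0 with rfl | hv
  · simp [mgf]
  have : (0 : ℝ) < v := by positivity
  have hexp (x : ℝ) : gaussianPDFReal 0 v x • Real.exp (t * x ^ 2) =
      (√(2 * Real.pi * v))⁻¹ * Real.exp (-((1 - 2 * v * t) / (2 * v)) * x ^ 2) := by
    rw [gaussianPDFReal, smul_eq_mul, mul_assoc, ← Real.exp_add]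
    congr 2
    field_simp
    ring
  rw [mgf, integral_gaussianReal_eq_integral_smul hv]
  simp_rw [hexp]
  rw [integral_const_mul, integral_gaussian, ← Real.sqrt_inv,
    ← Real.sqrt_mul (by positivity), ← Real.sqrt_inv]
  congr 1
  rcases eq_or_ne (1 - 2 * v * t) 0 with h | h
  · simp [h]
  · field_simp

lemma mgf_norm_sq_complexGaussian (v : ℝ≥0) (t : ℝ) :
    mgf (fun z => ‖z‖ ^ 2) (complexGaussian v) t = (√(1 - v * t))⁻¹ ^ 2 := by
  have hsplit (q : ℝ × ℝ) : Real.exp (t * ‖(⟨q.1, q.2⟩ : ℂ)‖ ^ 2) =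
      Real.exp (t * q.1 ^ 2) * Real.exp (t * q.2 ^ 2) := by
    rw [← Real.exp_add, ← Complex.normSq_eq_norm_sq, Complex.normSq_apply]
    ring_nf
  have hvt : (1 : ℝ) - 2 * ((v / 2 : ℝ≥0) : ℝ) * t = 1 - v * t := by
    push_cast
    ring
  rw [mgf, integral_complexGaussian v (by fun_prop)]
  simp_rw [hsplit]
  rw [integral_prod_mul (fun x : ℝ => Real.exp (t * x ^ 2)) fun y : ℝ => Real.exp (t * y ^ 2),
    ← sq]
  congr 1
  rw [← hvt]
  exact mgf_sq_gaussianReal (v / 2) t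

end ComplexGaussian

section ComplexGaussianMoments

variable (v : ℝ≥0)

lemma memLp_two_complexGaussian : MemLp (fun z : ℂ => z) 2 (complexGaussian v) := by
  have hsq : Integrable (fun x : ℝ => x ^ 2) (gaussianReal 0 (v / 2)) :=
    (memLp_id_gaussianReal 2).integrable_sq
  rw [memLp_two_iff_integrable_sq_norm (by fun_prop), complexGaussian,
    integrable_map_measure (by fun_prop) measurable_complex_mk.aemeasurable]
  refine ((hsq.comp_fst (gaussianReal 0 (v / 2))).add
    (hsq.comp_snd (gaussianReal 0 (v / 2)))).congr (.of_forall fun q => ?_)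
  simp only [Function.comp_apply, Pi.add_apply, Complex.sq_norm, Complex.normSq_mk, ← sq]

lemma integral_id_complexGaussian : ∫ z, z ∂complexGaussian v = 0 := by
  have hid : Integrable (fun x : ℝ => (x : ℂ)) (gaussianReal 0 (v / 2)) :=
    ((memLp_id_gaussianReal 1).integrable le_rfl).ofReal
  have hmean : ∫ x : ℝ, (x : ℂ) ∂gaussianReal 0 (v / 2) = 0 := by
    rw [integral_complex_ofReal, integral_id_gaussianReal, Complex.ofReal_zero]
  rw [integral_complexGaussian v (by fun_prop)]
  simp_rw [Complex.mk_eq_add_mul_I]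
  rw [integral_add (hid.comp_fst _) ((hid.comp_snd _).mul_const _), integral_mul_const,
    integral_fun_fst (fun x : ℝ => (x : ℂ)), integral_fun_snd (fun x : ℝ => (x : ℂ)), hmean]
  simp only [smul_zero, zero_mul, add_zero]

lemma integral_norm_sq_complexGaussian : ∫ z, ‖z‖ ^ 2 ∂complexGaussian v = v := by
  have hsq : Integrable (fun x : ℝ => x ^ 2) (gaussianReal 0 (v / 2)) :=
    (memLp_id_gaussianReal 2).integrable_sq
  have hvar : ∫ x, x ^ 2 ∂gaussianReal 0 (v / 2) = v / 2 := by
    have h := variance_fun_id_gaussianReal (μ := 0) (v := v / 2)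
    rwa [variance_of_integral_eq_zero aemeasurable_id' integral_id_gaussianReal] at h
  rw [integral_complexGaussian v (by fun_prop)]
  simp_rw [← Complex.normSq_eq_norm_sq, Complex.normSq_mk, ← sq]
  rw [integral_add (hsq.comp_fst _) (hsq.comp_snd _), integral_fun_fst (fun x : ℝ => x ^ 2),
    integral_fun_snd (fun x : ℝ => x ^ 2), hvar, probReal_univ, one_smul, add_halves]

end ComplexGaussianMoments

/-- The law `CN(0, I)` of a vector of independent standard complex Gaussian entries. -/
def stdComplexGaussian (ι : Type*) [Fintype ι] : Measure (ι → ℂ) :=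
  Measure.pi fun _ => complexGaussian 1

section StdComplexGaussian

variable {ι κ : Type*} [Fintype ι] [Fintype κ]

instance isProbabilityMeasure_stdComplexGaussian :
    IsProbabilityMeasure (stdComplexGaussian ι) := by
  unfold stdComplexGaussian
  infer_instance

lemma iIndepFun_eval_stdComplexGaussian :
    iIndepFun (fun (i : ι) (z : ι → ℂ) => z i) (stdComplexGaussian ι) :=
  iIndepFun_pi (X := fun _ => id) fun _ => aemeasurable_id

lemma hasLaw_eval_stdComplexGaussian (i : ι) :
    HasLaw (fun z => z i) (complexGaussian 1) (stdComplexGaussian ι) :=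
  (measurePreserving_eval (fun _ : ι => complexGaussian 1) i).hasLaw

lemma charFun_stdComplexGaussian (t : EuclideanSpace ℂ ι) :
    charFun ((stdComplexGaussian ι).map (WithLp.toLp 2)) t =
      Complex.exp (-(‖t‖ ^ 2 / 4 : ℝ)) := by
  rw [stdComplexGaussian, charFun_pi]
  simp_rw [charFun_complexGaussian]
  rw [← Complex.exp_sum, EuclideanSpace.norm_sq_eq, Finset.sum_div, Complex.ofReal_sum,
    Finset.sum_neg_distrib]
  simp only [NNReal.coe_one, one_mul]

lemma real_inner_toLp (u w : ι → ℂ) :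
    inner ℝ (WithLp.toLp 2 u : EuclideanSpace ℂ ι) (WithLp.toLp 2 w) = (star u ⬝ᵥ w).re := by
  simp only [PiLp.inner_apply, Complex.inner, dotProduct, Complex.re_sum, Pi.star_apply,
    RCLike.star_def, mul_comm]

lemma real_inner_toLp_mulVec (C : Matrix κ ι ℂ) (x : ι → ℂ) (t : κ → ℂ) :
    inner ℝ (WithLp.toLp 2 (C *ᵥ x) : EuclideanSpace ℂ κ) (WithLp.toLp 2 t) =
      inner ℝ (WithLp.toLp 2 x : EuclideanSpace ℂ ι) (WithLp.toLp 2 (Cᴴ *ᵥ t)) := by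
  rw [real_inner_toLp, real_inner_toLp, Matrix.star_mulVec, Matrix.dotProduct_mulVec]

lemma norm_toLp_conjTranspose_mulVec [DecidableEq κ] {C : Matrix κ ι ℂ} (hC : C * Cᴴ = 1)
    (t : κ → ℂ) :
    ‖(WithLp.toLp 2 (Cᴴ *ᵥ t) : EuclideanSpace ℂ ι)‖ ^ 2 =
      ‖(WithLp.toLp 2 t : EuclideanSpace ℂ κ)‖ ^ 2 := by
  rw [← real_inner_self_eq_norm_sq, ← real_inner_self_eq_norm_sq, ← real_inner_toLp_mulVec,
    Matrix.mulVec_mulVec, hC, Matrix.one_mulVec]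

lemma hasLaw_mulVec_stdComplexGaussian [DecidableEq κ] {C : Matrix κ ι ℂ} (hC : C * Cᴴ = 1) :
    HasLaw (fun x => C *ᵥ x) (stdComplexGaussian κ) (stdComplexGaussian ι) := by
  have hm : Measurable fun x : ι → ℂ => C *ᵥ x :=
    (continuous_const.matrix_mulVec continuous_id).measurable
  have := Measure.isProbabilityMeasure_map (μ := stdComplexGaussian ι) hm.aemeasurable
  refine ⟨hm.aemeasurable, (charFun_eq_pi_iff (μ := fun _ : κ => complexGaussian 1)).1
    fun t => ?_⟩
  have hpi := charFun_stdComplexGaussian t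
  rw [stdComplexGaussian, charFun_pi] at hpi
  rw [hpi, ← WithLp.toLp_ofLp 2 t, ← norm_toLp_conjTranspose_mulVec hC,
    ← charFun_stdComplexGaussian, charFun_apply, charFun_apply,
    integral_map (by fun_prop) (by fun_prop), integral_map hm.aemeasurable (by fun_prop),
    integral_map (by fun_prop) (by fun_prop)]
  simp_rw [real_inner_toLp_mulVec]

lemma hasLaw_sum_norm_sq_stdComplexGaussian {s : Finset ι} (hs : s.Nonempty) :
    HasLaw (fun z => ∑ i ∈ s, ‖z i‖ ^ 2) (gammaMeasure s.card 1) (stdComplexGaussian ι) := by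
  have hn : (0 : ℝ) < s.card := by exact_mod_cast hs.card_pos
  have := isProbabilityMeasure_gammaMeasure hn one_pos
  have hm : Measurable fun z : ι → ℂ => ∑ i ∈ s, ‖z i‖ ^ 2 := by fun_prop
  have := Measure.isProbabilityMeasure_map (μ := stdComplexGaussian ι) hm.aemeasurable
  have hmgf_gamma (t : ℝ) : mgf id (gammaMeasure s.card 1) t = ((√(1 - t))⁻¹ ^ 2) ^ s.card := by
    rw [mgf_id_gammaMeasure hn one_pos]
    split_ifs with ht
    · rw [inv_pow, Real.sq_sqrt (by linarith), Real.rpow_natCast, one_div]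
    · rw [Real.sqrt_eq_zero_of_nonpos (by linarith), inv_zero, zero_pow two_ne_zero,
        zero_pow hs.card_ne_zero]
  have hmgf (t : ℝ) : mgf (fun z : ι → ℂ => ∑ i ∈ s, ‖z i‖ ^ 2) (stdComplexGaussian ι) t =
      ((√(1 - t))⁻¹ ^ 2) ^ s.card := by
    have hcoord (i : ι) : mgf (fun z : ι → ℂ => ‖z i‖ ^ 2) (stdComplexGaussian ι) t =
        (√(1 - t))⁻¹ ^ 2 := by
      have h := mgf_norm_sq_complexGaussian 1 t
      rw [NNReal.coe_one, one_mul] at h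
      rw [← h]
      exact (hasLaw_eval_stdComplexGaussian i).integral_comp (f := fun w => Real.exp (t * ‖w‖ ^ 2))
        (by fun_prop)
    have hindep := (iIndepFun_eval_stdComplexGaussian (ι := ι)).comp (fun _ w => ‖w‖ ^ 2)
      fun _ => by fun_prop
    have hsum := hindep.mgf_sum (fun i => by fun_prop) s (t := t)
    calc mgf (fun z : ι → ℂ => ∑ i ∈ s, ‖z i‖ ^ 2) (stdComplexGaussian ι) t
        = mgf (∑ i ∈ s, (fun w : ℂ => ‖w‖ ^ 2) ∘ fun z : ι → ℂ => z i)
            (stdComplexGaussian ι) t := by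
          simp only [mgf, Finset.sum_apply, Function.comp_apply]
      _ = ((√(1 - t))⁻¹ ^ 2) ^ s.card := by
          rw [hsum, ← Finset.prod_const]
          exact Finset.prod_congr rfl fun i _ => hcoord i
  refine ⟨hm.aemeasurable, (ext_of_mgf_id_eq ?_ ?_).symm⟩
  · refine mem_interior_iff_mem_nhds.2 (mem_of_superset (Iio_mem_nhds one_pos) fun t ht => ?_)
    refine Integrable.of_integral_ne_zero (ne_of_eq_of_ne (hmgf_gamma t) ?_)
    have : 0 < √(1 - t) := Real.sqrt_pos.2 (sub_pos.2 ht)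
    positivity
  · funext t
    rw [hmgf_gamma, mgf_id_map hm.aemeasurable, hmgf]

end StdComplexGaussian

section SqNorm

variable {M : ℕ}

lemma sqNorm_nonneg (v : Fin M → ℂ) : 0 ≤ sqNorm v :=
  Finset.sum_nonneg fun _ _ => sq_nonneg _

lemma measurable_sqNorm : Measurable (sqNorm (M := M)) := by
  unfold sqNorm
  fun_prop

lemma sqNorm_smul (c : ℂ) (v : Fin M → ℂ) : sqNorm (c • v) = ‖c‖ ^ 2 * sqNorm v := by
  simp only [sqNorm, Pi.smul_apply, smul_eq_mul, norm_mul, mul_pow, Finset.mul_sum]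

lemma ofReal_sqNorm (v : Fin M → ℂ) : (sqNorm v : ℂ) = star v ⬝ᵥ v := by
  simp only [sqNorm, dotProduct, Pi.star_apply, RCLike.star_def, RCLike.conj_mul,
    Complex.ofReal_sum, Complex.ofReal_pow, Complex.coe_algebraMap]

lemma sqNorm_mulVec_of_conjTranspose_mul_self {U : Matrix (Fin M) (Fin M) ℂ} (hU : Uᴴ * U = 1)
    (v : Fin M → ℂ) : sqNorm (U *ᵥ v) = sqNorm v := by
  have h : (sqNorm (U *ᵥ v) : ℂ) = sqNorm v := by
    rw [ofReal_sqNorm, ofReal_sqNorm, Matrix.star_mulVec, ← Matrix.dotProduct_mulVec,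
      Matrix.mulVec_mulVec, hU, Matrix.one_mulVec]
  exact_mod_cast h

end SqNorm

section OrthogonalProjection

variable {M : ℕ} {Q : Matrix (Fin M) (Fin M) ℂ}

lemma exists_sqNorm_mulVec_eq_sum (hQ : Q.IsHermitian) (hQQ : IsIdempotentElem Q) :
    ∃ (C : Matrix (Fin M) (Fin M) ℂ) (s : Finset (Fin M)), C * Cᴴ = 1 ∧
      (s.card : ℂ) = Q.trace ∧ ∀ y, sqNorm (Q *ᵥ y) = ∑ i ∈ s, ‖(C *ᵥ y) i‖ ^ 2 := by
  set U : Matrix (Fin M) (Fin M) ℂ := hQ.eigenvectorUnitary.1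
  set ev := hQ.eigenvalues
  have hUU : Uᴴ * U = 1 := Unitary.coe_star_mul_self _
  have hspec : Q = U * Matrix.diagonal (fun i => (ev i : ℂ)) * Uᴴ := hQ.spectral_theorem
  have hev (i : Fin M) : ev i = 0 ∨ ev i = 1 :=
    hQQ.spectrum_subset ℝ (hQ.eigenvalues_mem_spectrum_real i)
  refine ⟨Uᴴ, Finset.univ.filter (ev · = 1), by rwa [Matrix.conjTranspose_conjTranspose], ?_,
    fun y => ?_⟩
  · rw [hQ.trace_eq_sum_eigenvalues, ← Finset.sum_boole]
    refine Finset.sum_congr rfl fun i _ => ?_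
    rcases hev i with h | h <;> simp [ev, h]
  · conv_lhs => rw [hspec, Matrix.mul_assoc, ← Matrix.mulVec_mulVec, ← Matrix.mulVec_mulVec,
      sqNorm_mulVec_of_conjTranspose_mul_self hUU]
    rw [sqNorm, Finset.sum_filter]
    refine Finset.sum_congr rfl fun i _ => ?_
    rw [Matrix.mulVec_diagonal]
    rcases hev i with h | h <;> simp [h]

lemma hasLaw_sqNorm_mulVec (hQ : Q.IsHermitian) (hQQ : IsIdempotentElem Q) {n : ℕ} (hn : n ≠ 0)
    (htr : Q.trace = n) :
    HasLaw (fun y => sqNorm (Q *ᵥ y)) (gammaMeasure n 1) (stdComplexGaussian (Fin M)) := by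
  obtain ⟨C, s, hC, hs, hsq⟩ := exists_sqNorm_mulVec_eq_sum hQ hQQ
  have hsn : s.card = n := by exact_mod_cast hs.trans htr
  have hne : s.Nonempty := Finset.card_ne_zero.1 (hsn ▸ hn)
  simp_rw [hsq, ← hsn]
  exact (hasLaw_sum_norm_sq_stdComplexGaussian hne).fun_comp (hasLaw_mulVec_stdComplexGaussian hC)

end OrthogonalProjection

section Pseudoinverse

variable {M : ℕ} {ι : Type*}

/-- The matrix `H` without its column `k`. -/
def dropCol (H : Matrix (Fin M) ι ℂ) (k : ι) : Matrix (Fin M) {i // i ≠ k} ℂ :=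
  H.submatrix id Subtype.val

lemma linearIndependent_col_dropCol {H : Matrix (Fin M) ι ℂ} (hH : LinearIndependent ℂ H.col)
    (k : ι) :
    LinearIndependent ℂ (dropCol H k).col :=
  hH.comp Subtype.val Subtype.val_injective

variable [Fintype ι] [DecidableEq ι]

/-- The Moore–Penrose right inverse `H (Hᴴ H)⁻¹` of `Hᴴ`, for a matrix `H` with linearly
independent columns. -/
def pinv (H : Matrix (Fin M) ι ℂ) : Matrix (Fin M) ι ℂ := H * (Hᴴ * H)⁻¹

/-- The projection onto the orthogonal complement of the columns of `H`, provided that these are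
linearly independent. -/
def orthProj (H : Matrix (Fin M) ι ℂ) : Matrix (Fin M) (Fin M) ℂ := 1 - pinv H * Hᴴ

lemma isHermitian_orthProj (H : Matrix (Fin M) ι ℂ) : (orthProj H).IsHermitian :=
  Matrix.isHermitian_one.sub
    (Matrix.isHermitian_mul_mul_conjTranspose H (Matrix.isHermitian_conjTranspose_mul_self H).inv)

lemma inv_diagonal_of_ne_zero {d : ι → ℂ} (hd : ∀ i, d i ≠ 0) :
    (Matrix.diagonal d)⁻¹ = Matrix.diagonal fun i => (d i)⁻¹ := by
  refine Matrix.inv_eq_right_inv ?_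
  simp_rw [Matrix.diagonal_mul_diagonal, fun i => mul_inv_cancel₀ (hd i), Matrix.diagonal_one]

lemma pinv_mul_diagonal (H : Matrix (Fin M) ι ℂ) {d : ι → ℂ} (hd : ∀ i, d i ≠ 0) :
    pinv (H * Matrix.diagonal d) = pinv H * Matrix.diagonal fun i => (star (d i))⁻¹ := by
  have hD : Matrix.diagonal d * (Matrix.diagonal d)⁻¹ = 1 := by
    simp_rw [inv_diagonal_of_ne_zero hd, Matrix.diagonal_mul_diagonal,
      fun i => mul_inv_cancel₀ (hd i), Matrix.diagonal_one]
  have hstar : (Matrix.diagonal d)ᴴ⁻¹ = Matrix.diagonal fun i => (star (d i))⁻¹ := by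
    rw [Matrix.diagonal_conjTranspose]
    exact inv_diagonal_of_ne_zero fun i => star_ne_zero.2 (hd i)
  calc pinv (H * Matrix.diagonal d)
      = H * Matrix.diagonal d *
          ((Matrix.diagonal d)ᴴ * ((Hᴴ * H) * Matrix.diagonal d))⁻¹ := by
        simp only [pinv, Matrix.conjTranspose_mul, Matrix.mul_assoc]
    _ = H * (Matrix.diagonal d * (Matrix.diagonal d)⁻¹) * (Hᴴ * H)⁻¹ * (Matrix.diagonal d)ᴴ⁻¹ := by
        rw [Matrix.mul_inv_rev (Matrix.diagonal d)ᴴ, Matrix.mul_inv_rev (Hᴴ * H)]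
        simp only [Matrix.mul_assoc]
    _ = pinv H * Matrix.diagonal fun i => (star (d i))⁻¹ := by
        rw [hD, Matrix.mul_one, hstar, pinv]

lemma orthProj_mul_diagonal (H : Matrix (Fin M) ι ℂ) {d : ι → ℂ} (hd : ∀ i, d i ≠ 0) :
    orthProj (H * Matrix.diagonal d) = orthProj H := by
  have hstar (i : ι) : (star (d i))⁻¹ * star (d i) = 1 :=
    inv_mul_cancel₀ (star_ne_zero.2 (hd i))
  rw [orthProj, pinv_mul_diagonal H hd, Matrix.conjTranspose_mul, Matrix.diagonal_conjTranspose,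
    Matrix.mul_assoc, ← Matrix.mul_assoc (Matrix.diagonal _), Matrix.diagonal_mul_diagonal]
  simp_rw [Pi.star_apply, hstar, Matrix.diagonal_one, Matrix.one_mul]
  rfl

variable {H : Matrix (Fin M) ι ℂ}

lemma isUnit_det_conjTranspose_mul_self (hH : LinearIndependent ℂ H.col) :
    IsUnit (Hᴴ * H).det := by
  rw [isUnit_iff_ne_zero]
  open scoped ComplexOrder in
  exact (Matrix.PosDef.conjTranspose_mul_self _ (Matrix.mulVec_injective_iff.2 hH)).det_pos.ne'

lemma conjTranspose_mul_pinv (hH : LinearIndependent ℂ H.col) : Hᴴ * pinv H = 1 := by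
  rw [pinv, ← Matrix.mul_assoc, Matrix.mul_nonsing_inv _ (isUnit_det_conjTranspose_mul_self hH)]

lemma conjTranspose_mul_orthProj (hH : LinearIndependent ℂ H.col) : Hᴴ * orthProj H = 0 := by
  rw [orthProj, Matrix.mul_sub, Matrix.mul_one, ← Matrix.mul_assoc, conjTranspose_mul_pinv hH,
    Matrix.one_mul, sub_self]

lemma orthProj_mul_self_eq_zero (hH : LinearIndependent ℂ H.col) : orthProj H * H = 0 := by
  rw [← (isHermitian_orthProj H).eq, ← Matrix.conjTranspose_conjTranspose H,
    ← Matrix.conjTranspose_mul, Matrix.conjTranspose_conjTranspose, conjTranspose_mul_orthProj hH,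
    Matrix.conjTranspose_zero]

lemma isIdempotentElem_orthProj (hH : LinearIndependent ℂ H.col) :
    IsIdempotentElem (orthProj H) := by
  rw [IsIdempotentElem]
  nth_rw 1 [orthProj]
  rw [Matrix.sub_mul, Matrix.one_mul, Matrix.mul_assoc, conjTranspose_mul_orthProj hH,
    Matrix.mul_zero, sub_zero]

lemma trace_orthProj (hH : LinearIndependent ℂ H.col) :
    (orthProj H).trace = M - Fintype.card ι := by
  rw [orthProj, Matrix.trace_sub, Matrix.trace_one, Matrix.trace_mul_comm,
    conjTranspose_mul_pinv hH, Matrix.trace_one, Fintype.card_fin]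

lemma star_orthProj_mulVec_dotProduct (x y : Fin M → ℂ) :
    star (orthProj H *ᵥ x) ⬝ᵥ y = star x ⬝ᵥ (orthProj H *ᵥ y) := by
  rw [Matrix.star_mulVec, (isHermitian_orthProj H).eq, Matrix.dotProduct_mulVec]

lemma star_dotProduct_orthProj_mulVec_self (hH : LinearIndependent ℂ H.col) (x : Fin M → ℂ) :
    star x ⬝ᵥ (orthProj H *ᵥ x) = sqNorm (orthProj H *ᵥ x) := by
  rw [ofReal_sqNorm, star_orthProj_mulVec_dotProduct, Matrix.mulVec_mulVec,
    isIdempotentElem_orthProj hH]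

lemma orthProj_mulVec_eq_self {v : Fin M → ℂ} (hv : Hᴴ *ᵥ v = 0) : orthProj H *ᵥ v = v := by
  rw [orthProj, Matrix.sub_mulVec, Matrix.one_mulVec, ← Matrix.mulVec_mulVec, hv,
    Matrix.mulVec_zero, sub_zero]

lemma orthProj_dropCol_mulVec_mulVec (hH : LinearIndependent ℂ H.col) (k : ι) (c : ι → ℂ) :
    orthProj (dropCol H k) *ᵥ (H *ᵥ c) = c k • (orthProj (dropCol H k) *ᵥ H.col k) := by
  have hother (i : ι) (hi : i ≠ k) : orthProj (dropCol H k) *ᵥ H.col i = 0 := funext fun m =>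
    congrFun (congrFun (orthProj_mul_self_eq_zero (linearIndependent_col_dropCol hH k)) m) ⟨i, hi⟩
  have hsum : H *ᵥ c = ∑ i, c i • H.col i := by
    ext m
    simp only [Matrix.mulVec, dotProduct, Finset.sum_apply, Pi.smul_apply, smul_eq_mul,
      Matrix.col_apply, mul_comm]
  rw [hsum, Matrix.mulVec_sum, Finset.sum_eq_single k, Matrix.mulVec_smul]
  · intro i _ hi
    rw [Matrix.mulVec_smul, hother i hi, smul_zero]
  · exact fun hk => absurd (Finset.mem_univ k) hk

lemma pinv_mulVec_single (hH : LinearIndependent ℂ H.col) (k : ι) :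
    pinv H *ᵥ Pi.single k 1 =
      ((sqNorm (orthProj (dropCol H k) *ᵥ H.col k) : ℂ))⁻¹ •
        (orthProj (dropCol H k) *ᵥ H.col k) := by
  set v := pinv H *ᵥ Pi.single k 1 with hv
  set u := orthProj (dropCol H k) *ᵥ H.col k with hu
  set c := (Hᴴ * H)⁻¹ *ᵥ Pi.single k 1
  have hHv : Hᴴ *ᵥ v = Pi.single k 1 := by
    rw [hv, Matrix.mulVec_mulVec, conjTranspose_mul_pinv hH, Matrix.one_mulVec]
  have hdrop : (dropCol H k)ᴴ *ᵥ v = 0 := funext fun i =>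
    (congrFun hHv i.1).trans (Pi.single_eq_of_ne i.2 1)
  have hvu : v = c k • u := by
    rw [← orthProj_mulVec_eq_self hdrop, hu, ← orthProj_dropCol_mulVec_mulVec hH,
      Matrix.mulVec_mulVec _ H, hv, pinv]
  have hcol : star (H.col k) ⬝ᵥ v = 1 := (congrFun hHv k).trans (Pi.single_eq_same k 1)
  have hc : c k * sqNorm u = 1 := by
    rw [← hcol, hvu, dotProduct_smul, smul_eq_mul, hu,
      star_dotProduct_orthProj_mulVec_self (linearIndependent_col_dropCol hH k)]
  rw [hvu, eq_inv_of_mul_eq_one_left hc]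

lemma sqNorm_pinv_mulVec_single (hH : LinearIndependent ℂ H.col) (k : ι) :
    sqNorm (pinv H *ᵥ Pi.single k 1) = (sqNorm (orthProj (dropCol H k) *ᵥ H.col k))⁻¹ := by
  rw [pinv_mulVec_single hH, sqNorm_smul, ← Complex.ofReal_inv, Complex.norm_real, Real.norm_eq_abs,
    sq_abs]
  rcases eq_or_ne (sqNorm (orthProj (dropCol H k) *ᵥ H.col k)) 0 with h | h
  · rw [h, inv_zero, mul_zero]
  · field_simp

end Pseudoinverse

section Measurability

variable {α ι : Type*} [MeasurableSpace α] {M : ℕ}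

lemma measurable_mulVec {m n : Type*} [Fintype n] {A : α → Matrix m n ℂ} {x : α → n → ℂ}
    (hA : ∀ i j, Measurable fun a => A a i j) (hx : Measurable x) :
    Measurable fun a => A a *ᵥ x a := by
  refine measurable_pi_lambda _ fun i => ?_
  simp only [Matrix.mulVec, dotProduct]
  fun_prop

variable [Fintype ι] [DecidableEq ι]

lemma measurable_inv_apply {A : α → Matrix ι ι ℂ} (hA : ∀ i j, Measurable fun a => A a i j)
    (i j : ι) : Measurable fun a => (A a)⁻¹ i j := by
  have hA' : Measurable fun a => Matrix.of.symm (A a) := by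
    exact measurable_pi_lambda _ fun i => measurable_pi_lambda _ (hA i)
  have hdet : Measurable fun x : ι → ι → ℂ => (Matrix.of x).det :=
    (show Continuous fun x : ι → ι → ℂ => (Matrix.of x).det by fun_prop).measurable
  have hadj : Measurable fun x : ι → ι → ℂ => (Matrix.of x).adjugate i j :=
    (show Continuous fun x : ι → ι → ℂ => (Matrix.of x).adjugate i j by fun_prop).measurable
  simp only [Matrix.inv_def, Ring.inverse_eq_inv', Matrix.smul_apply, smul_eq_mul]
  exact (hdet.comp hA').inv.mul (hadj.comp hA')

variable {H : α → Matrix (Fin M) ι ℂ}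

lemma measurable_pinv_apply (hH : ∀ m i, Measurable fun a => H a m i) (m : Fin M) (i : ι) :
    Measurable fun a => pinv (H a) m i := by
  have hgram : ∀ i j, Measurable fun a => ((H a)ᴴ * H a) i j := fun i j => by
    simp only [Matrix.mul_apply, Matrix.conjTranspose_apply]
    fun_prop
  simp only [pinv, Matrix.mul_apply]
  exact Finset.measurable_sum _ fun j _ => (hH m j).mul (measurable_inv_apply hgram j i)

lemma measurable_orthProj_apply (hH : ∀ m i, Measurable fun a => H a m i) (m n : Fin M) :
    Measurable fun a => orthProj (H a) m n := by
  have hpinv := measurable_pinv_apply hH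
  simp only [orthProj, Matrix.sub_apply, Matrix.mul_apply, Matrix.conjTranspose_apply]
  fun_prop

end Measurability

section IndependentProjection

variable {Ω : Type*} [MeasurableSpace Ω] {P : Measure Ω}

lemma hasLaw_of_indepFun {𝓧 𝓨 𝓩 : Type*} [MeasurableSpace 𝓧] [MeasurableSpace 𝓨]
    [MeasurableSpace 𝓩] {ν : Measure 𝓨} [IsProbabilityMeasure ν] {μ : Measure 𝓩} {X : Ω → 𝓧}
    {Y : Ω → 𝓨} (hX : AEMeasurable X P) (hY : HasLaw Y ν P) (hXY : IndepFun X Y P)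
    {F : 𝓧 × 𝓨 → 𝓩} (hF : Measurable F)
    (hlaw : ∀ᵐ ω ∂P, HasLaw (fun y => F (X ω, y)) μ ν) :
    HasLaw (fun ω => F (X ω, Y ω)) μ P := by
  have := hY.isProbabilityMeasure
  have hpair : HasLaw (fun ω => (X ω, Y ω)) ((P.map X).prod ν) P :=
    hXY.hasLaw_prod ⟨hX, rfl⟩ hY
  refine ⟨hF.comp_aemeasurable hpair.aemeasurable, ?_⟩
  ext s hs
  have hsection : ∀ᵐ ω ∂P, ν (Prod.mk (X ω) ⁻¹' (F ⁻¹' s)) = μ s := by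
    filter_upwards [hlaw] with ω hω
    rw [← hω.map_eq]
    exact (Measure.map_apply (hF.comp measurable_prodMk_left) hs).symm
  calc P.map (fun ω => F (X ω, Y ω)) s
      = ((P.map X).prod ν) (F ⁻¹' s) := by
        rw [← hpair.map_eq, Measure.map_apply_of_aemeasurable hpair.aemeasurable (hF hs)]
        exact Measure.map_apply_of_aemeasurable (hF.comp_aemeasurable hpair.aemeasurable) hs
    _ = ∫⁻ ω, ν (Prod.mk (X ω) ⁻¹' (F ⁻¹' s)) ∂P := by
        rw [Measure.prod_apply (hF hs),
          lintegral_map' (measurable_measure_prodMk_left (hF hs)).aemeasurable hX]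
    _ = μ s := by rw [lintegral_congr_ae hsection, lintegral_const, measure_univ, mul_one]

/-- The matrix with columns `x i`. -/
def colMat {M : ℕ} {ι : Type*} (x : ι → Fin M → ℂ) : Matrix (Fin M) ι ℂ := (Matrix.of x)ᵀ

variable {M : ℕ} {ι : Type*} [Fintype ι] [DecidableEq ι]

lemma measurable_orthProj_colMat_mulVec :
    Measurable fun q : (ι → Fin M → ℂ) × (Fin M → ℂ) => orthProj (colMat q.1) *ᵥ q.2 :=
  measurable_mulVec (measurable_orthProj_apply fun m i => by
    simp only [colMat, Matrix.transpose_apply, Matrix.of_apply]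
    fun_prop) measurable_snd

lemma hasLaw_sqNorm_orthProj_mulVec {x : Ω → ι → Fin M → ℂ} {y : Ω → Fin M → ℂ}
    (hx : AEMeasurable x P) (hy : HasLaw y (stdComplexGaussian (Fin M)) P) (hxy : IndepFun x y P)
    (hli : ∀ᵐ ω ∂P, LinearIndependent ℂ (x ω)) (hι : Fintype.card ι < M) :
    HasLaw (fun ω => sqNorm (orthProj (colMat (x ω)) *ᵥ y ω))
      (gammaMeasure (M - Fintype.card ι : ℕ) 1) P := by
  refine hasLaw_of_indepFun hx hy hxy
    (F := fun q : (ι → Fin M → ℂ) × (Fin M → ℂ) => sqNorm (orthProj (colMat q.1) *ᵥ q.2))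
    (measurable_sqNorm.comp measurable_orthProj_colMat_mulVec) ?_
  filter_upwards [hli] with ω hω
  have hcol : LinearIndependent ℂ (colMat (x ω)).col := hω
  refine hasLaw_sqNorm_mulVec (isHermitian_orthProj _) (isIdempotentElem_orthProj hcol)
    (Nat.sub_pos_of_lt hι).ne' ?_
  rw [trace_orthProj hcol, Nat.cast_sub hι.le]

end IndependentProjection

/-- Independent standard complex Gaussian vectors `z k`. -/
structure IsStdGaussianFamily {Ω κ ι : Type*} [MeasurableSpace Ω] [Fintype ι] (P : Measure Ω)
    (z : κ → Ω → ι → ℂ) : Prop where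
  indep : iIndepFun z P
  law : ∀ k, HasLaw (z k) (stdComplexGaussian ι) P

namespace IsStdGaussianFamily

variable {Ω : Type*} [MeasurableSpace Ω] {P : Measure Ω} {M : ℕ} {κ : Type*}
  {z : κ → Ω → Fin M → ℂ}

lemma indepFun_of_notMem_range (h : IsStdGaussianFamily P z) {ι : Type*} [Finite ι] {f : ι → κ}
    {k : κ} (hk : k ∉ Set.range f) : IndepFun (fun ω i => z (f i) ω) (z k) P := by
  classical
  have := Fintype.ofFinite ι
  let T : Finset κ := Finset.univ.image f
  have hf (i : ι) : f i ∈ T := Finset.mem_image_of_mem f (Finset.mem_univ i)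
  have hT : Disjoint T {k} := by simpa [T] using hk
  have hind := h.indep.indepFun_finset₀ T {k} hT fun i => (h.law i).aemeasurable
  have hcols : Measurable fun (x : T → Fin M → ℂ) (i : ι) => x ⟨f i, hf i⟩ := by fun_prop
  have hcol : Measurable fun x : ({k} : Finset κ) → Fin M → ℂ => x ⟨k, by simp⟩ := by fun_prop
  exact hind.comp hcols hcol

-- A new column is almost surely outside the span of the earlier ones, because the projection off
-- that span kills the span, while the squared norm of the projected column is Gamma distributed.
lemma ae_linearIndepOn (h : IsStdGaussianFamily P z) (T : Finset κ) (hT : T.card ≤ M) :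
    ∀ᵐ ω ∂P, LinearIndepOn ℂ (fun k => z k ω) (T : Set κ) := by
  classical
  induction T using Finset.induction_on with
  | empty => simp
  | insert a T ha ih =>
    rw [Finset.card_insert_of_notMem ha] at hT
    have hli : ∀ᵐ ω ∂P, LinearIndependent ℂ fun k : T => z k ω := ih (by lia)
    have hlaw := hasLaw_sqNorm_orthProj_mulVec
      (aemeasurable_pi_lambda _ fun k : T => (h.law k).aemeasurable) (h.law a)
      (h.indepFun_of_notMem_range (by simpa using ha)) hli (by rw [Fintype.card_coe]; lia)
    have hpos := (hlaw.ae_iff measurableSet_Ioi.mem).2 (ae_pos_gammaMeasure _ _)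
    filter_upwards [hli, hpos] with ω hω hω_pos
    rw [Finset.coe_insert]
    refine LinearIndepOn.insert hω fun hmem => ?_
    have hle : Submodule.span ℂ ((fun k => z k ω) '' (T : Set κ)) ≤
        LinearMap.ker (orthProj (colMat fun k : T => z k ω)).mulVecLin := by
      rw [Submodule.span_le]
      rintro _ ⟨k, hk, rfl⟩
      ext m
      exact congrFun (congrFun (orthProj_mul_self_eq_zero (H := colMat _) hω) m) ⟨k, hk⟩
    have hzero : orthProj (colMat fun k : T => z k ω) *ᵥ z a ω = 0 := hle hmem
    rw [hzero] at hω_pos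
    simp [sqNorm] at hω_pos

variable {ι : Type*} [Fintype ι] {f : ι → κ}

lemma ae_linearIndependent (h : IsStdGaussianFamily P z) (hf : Function.Injective f)
    (hι : Fintype.card ι ≤ M) : ∀ᵐ ω ∂P, LinearIndependent ℂ fun i => z (f i) ω := by
  classical
  have hcard : (Finset.univ.image f).card ≤ M := by
    rwa [Finset.card_image_of_injective _ hf, Finset.card_univ]
  filter_upwards [h.ae_linearIndepOn _ hcard] with ω hω
  exact hω.comp (fun i => ⟨f i, by simp⟩) fun i j hij => hf (by simpa using hij)

lemma hasLaw_sqNorm_orthProj [DecidableEq ι] (h : IsStdGaussianFamily P z)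
    (hf : Function.Injective f) (hι : Fintype.card ι < M) {k : κ} (hk : k ∉ Set.range f) :
    HasLaw (fun ω => sqNorm (orthProj (colMat fun i => z (f i) ω) *ᵥ z k ω))
      (gammaMeasure (M - Fintype.card ι : ℕ) 1) P :=
  hasLaw_sqNorm_orthProj_mulVec (aemeasurable_pi_lambda _ fun i => (h.law (f i)).aemeasurable)
    (h.law k) (h.indepFun_of_notMem_range hk) (h.ae_linearIndependent hf hι.le) hι

end IsStdGaussianFamily

section SecondMoments

variable {Ω : Type*} [MeasurableSpace Ω] {P : Measure Ω}

lemma ofReal_integral_norm_sq (X : Ω → ℂ) :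
    ((∫ ω, ‖X ω‖ ^ 2 ∂P : ℝ) : ℂ) = ∫ ω, X ω * conj (X ω) ∂P := by
  simp_rw [← integral_complex_ofReal, Complex.ofReal_pow, Complex.mul_conj']

lemma integral_norm_sq_sum {ι : Type*} {s : Finset ι} {X : ι → Ω → ℂ}
    (hX : ∀ i ∈ s, MemLp (X i) 2 P) :
    ((∫ ω, ‖∑ i ∈ s, X i ω‖ ^ 2 ∂P : ℝ) : ℂ) =
      ∑ i ∈ s, ∑ j ∈ s, ∫ ω, X i ω * conj (X j ω) ∂P := by
  have hint : ∀ i ∈ s, ∀ j ∈ s, Integrable (fun ω => X i ω * conj (X j ω)) P :=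
    fun i hi j hj => (hX i hi).integrable_mul (hX j hj).star
  rw [ofReal_integral_norm_sq]
  simp_rw [map_sum, Finset.sum_mul_sum]
  rw [integral_finsetSum _ fun i hi => integrable_finsetSum _ (hint i hi)]
  exact Finset.sum_congr rfl fun i hi => integral_finsetSum _ (hint i hi)

lemma integral_norm_sq_add {X Y : Ω → ℂ} (hX : MemLp X 2 P) (hY : MemLp Y 2 P)
    (hXY : ∫ ω, X ω * conj (Y ω) ∂P = 0) :
    ∫ ω, ‖X ω + Y ω‖ ^ 2 ∂P = ∫ ω, ‖X ω‖ ^ 2 ∂P + ∫ ω, ‖Y ω‖ ^ 2 ∂P := by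
  have hcross : Integrable (fun ω => X ω * conj (Y ω)) P := hX.integrable_mul hY.star
  have hre : ∫ ω, (X ω * conj (Y ω)).re ∂P = 0 :=
    (integral_re hcross).trans (congrArg Complex.re hXY)
  have hint : Integrable (fun ω => 2 * (X ω * conj (Y ω)).re) P := hcross.re.const_mul 2
  have hX2 : Integrable (fun ω => ‖X ω‖ ^ 2) P := hX.integrable_norm_pow two_ne_zero
  have hY2 : Integrable (fun ω => ‖Y ω‖ ^ 2) P := hY.integrable_norm_pow two_ne_zero
  have hadd : Integrable (fun ω => ‖X ω‖ ^ 2 + ‖Y ω‖ ^ 2) P := hX2.add hY2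
  simp_rw [Complex.sq_norm, Complex.normSq_add, ← Complex.sq_norm]
  rw [integral_add hadd hint, integral_add hX2 hY2, integral_const_mul, hre, mul_zero, add_zero]

lemma memLp_two_mul_of_indepFun {X Y : Ω → ℂ} (hX : MemLp X 2 P) (hY : MemLp Y 2 P)
    (hXY : IndepFun X Y P) : MemLp (fun ω => X ω * Y ω) 2 P := by
  have hm : AEStronglyMeasurable (fun ω => X ω * Y ω) P := hX.1.mul hY.1
  rw [memLp_two_iff_integrable_sq_norm hm]
  have hsq : IndepFun (fun ω => ‖X ω‖ ^ 2) (fun ω => ‖Y ω‖ ^ 2) P :=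
    hXY.comp (φ := fun x : ℂ => ‖x‖ ^ 2) (ψ := fun x : ℂ => ‖x‖ ^ 2) (by fun_prop) (by fun_prop)
  simp_rw [norm_mul, mul_pow]
  exact hsq.integrable_mul (hX.integrable_norm_pow two_ne_zero)
    (hY.integrable_norm_pow two_ne_zero)

lemma integral_norm_sq_sum_of_indepFun {ι : Type*} [Fintype ι] {X : ι → Ω → ℂ}
    (hX : ∀ i, MemLp (X i) 2 P) (hind : Pairwise fun i j => IndepFun (X i) (X j) P) :
    ∫ ω, ‖∑ i, X i ω‖ ^ 2 ∂P = ‖∑ i, ∫ ω, X i ω ∂P‖ ^ 2 +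
      ∑ i, (∫ ω, ‖X i ω‖ ^ 2 ∂P - ‖∫ ω, X i ω ∂P‖ ^ 2) := by
  classical
  have hcov : ∀ i j, ∫ ω, X i ω * conj (X j ω) ∂P = (∫ ω, X i ω ∂P) * conj (∫ ω, X j ω ∂P) +
      if i = j then ((∫ ω, ‖X i ω‖ ^ 2 ∂P - ‖∫ ω, X i ω ∂P‖ ^ 2 : ℝ) : ℂ) else 0 := by
    intro i j
    split_ifs with hij
    · rw [← hij, Complex.ofReal_sub, ofReal_integral_norm_sq, Complex.mul_conj',
        Complex.ofReal_pow, add_sub_cancel]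
    · have hconj : IndepFun (X i) (fun ω => conj (X j ω)) P :=
        (hind hij).comp measurable_id (ψ := fun x : ℂ => conj x) (by fun_prop)
      rw [hconj.integral_fun_mul_eq_mul_integral (hX i).1 (hX j).star.1, integral_conj, add_zero]
  have hsum := integral_norm_sq_sum (s := Finset.univ) fun i _ => hX i
  simp_rw [hcov, Finset.sum_add_distrib, ← Finset.sum_mul_sum, ← map_sum, Complex.mul_conj',
    Finset.sum_ite_eq, Finset.mem_univ, if_true] at hsum
  exact_mod_cast hsum

end SecondMoments

lemma integral_apply_mul_conj_stdComplexGaussian {ι : Type*} [Fintype ι] [DecidableEq ι]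
    (i j : ι) : ∫ z, z i * conj (z j) ∂stdComplexGaussian ι = if i = j then 1 else 0 := by
  have hL := hasLaw_eval_stdComplexGaussian (ι := ι)
  split_ifs with hij
  · rw [← hij, ← ofReal_integral_norm_sq]
    have h := (hL i).integral_comp (f := fun x : ℂ => ‖x‖ ^ 2) (by fun_prop)
    rw [integral_norm_sq_complexGaussian, Function.comp_def] at h
    rw [h, NNReal.coe_one, Complex.ofReal_one]
  · have hind : IndepFun (fun z : ι → ℂ => z i) (fun z => conj (z j)) (stdComplexGaussian ι) :=
      (iIndepFun_eval_stdComplexGaussian.indepFun hij).comp measurable_id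
        (ψ := fun x : ℂ => conj x) (by fun_prop)
    rw [hind.integral_fun_mul_eq_mul_integral (measurable_pi_apply i).aestronglyMeasurable
      (continuous_star.measurable.comp (measurable_pi_apply j)).aestronglyMeasurable,
      (hL i).integral_eq, integral_id_complexGaussian, zero_mul]

section GaussianInner

variable {Ω : Type*} [MeasurableSpace Ω] {P : Measure Ω} {M : ℕ} {e W : Ω → Fin M → ℂ}

lemma memLp_two_apply_of_integrable_sqNorm (hW : AEMeasurable W P)
    (hW2 : Integrable (fun ω => sqNorm (W ω)) P) (m : Fin M) : MemLp (fun ω => W ω m) 2 P := by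
  have hm : AEStronglyMeasurable (fun ω => W ω m) P :=
    ((measurable_pi_apply m).comp_aemeasurable hW).aestronglyMeasurable
  rw [memLp_two_iff_integrable_sq_norm hm]
  refine hW2.mono' (hm.norm.pow 2) (.of_forall fun ω => ?_)
  rw [Real.norm_of_nonneg (by positivity)]
  exact Finset.single_le_sum (f := fun m => ‖W ω m‖ ^ 2) (fun i _ => by positivity)
    (Finset.mem_univ m)

lemma memLp_two_apply_of_hasLaw (he : HasLaw e (stdComplexGaussian (Fin M)) P) (m : Fin M) :
    MemLp (fun ω => e ω m) 2 P := by
  have hm := (hasLaw_eval_stdComplexGaussian m).fun_comp he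
  exact MemLp.comp_of_map (hm.map_eq ▸ memLp_two_complexGaussian 1) hm.aemeasurable

lemma integral_apply_of_hasLaw (he : HasLaw e (stdComplexGaussian (Fin M)) P) (m : Fin M) :
    ∫ ω, e ω m ∂P = 0 := by
  rw [((hasLaw_eval_stdComplexGaussian m).fun_comp he).integral_eq, integral_id_complexGaussian]

lemma memLp_two_star_dotProduct (he : HasLaw e (stdComplexGaussian (Fin M)) P)
    (heW : IndepFun e W P) (hW : AEMeasurable W P)
    (hW2 : Integrable (fun ω => sqNorm (W ω)) P) :
    MemLp (fun ω => star (e ω) ⬝ᵥ W ω) 2 P :=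
  memLp_finsetSum _ fun m _ => memLp_two_mul_of_indepFun (memLp_two_apply_of_hasLaw he m).star
    (memLp_two_apply_of_integrable_sqNorm hW hW2 m)
    (heW.comp (φ := fun x : Fin M → ℂ => star (x m)) (ψ := fun x : Fin M → ℂ => x m)
      (by fun_prop) (by fun_prop))

lemma integral_star_dotProduct_mul {A : Ω → ℂ} (he : HasLaw e (stdComplexGaussian (Fin M)) P)
    (heWA : IndepFun e (fun ω => (W ω, A ω)) P) (hW : AEMeasurable W P)
    (hW2 : Integrable (fun ω => sqNorm (W ω)) P) (hA : MemLp A 2 P) :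
    ∫ ω, (star (e ω) ⬝ᵥ W ω) * A ω ∂P = 0 := by
  have hind : ∀ m, IndepFun (fun ω => star (e ω m)) (fun ω => W ω m * A ω) P := fun m =>
    heWA.comp (φ := fun x : Fin M → ℂ => star (x m))
      (ψ := fun q : (Fin M → ℂ) × ℂ => q.1 m * q.2) (by fun_prop) (by fun_prop)
  have he2 := fun m => (memLp_two_apply_of_hasLaw he m).star
  have hWA : ∀ m, Integrable (fun ω => W ω m * A ω) P := fun m =>
    (memLp_two_apply_of_integrable_sqNorm hW hW2 m).integrable_mul hA
  have : IsProbabilityMeasure P := he.isProbabilityMeasure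
  simp_rw [dotProduct, Finset.sum_mul, Pi.star_apply, mul_assoc]
  have hint : ∀ m ∈ Finset.univ, Integrable (fun ω => star (e ω m) * (W ω m * A ω)) P := fun m _ =>
    (hind m).integrable_mul ((he2 m).integrable one_le_two) (hWA m)
  rw [integral_finsetSum _ hint]
  refine Finset.sum_eq_zero fun m _ => ?_
  rw [(hind m).integral_fun_mul_eq_mul_integral (he2 m).1 (hWA m).1]
  simp only [RCLike.star_def, integral_conj, integral_apply_of_hasLaw he, map_zero, zero_mul]

lemma integral_norm_sq_star_dotProduct (he : HasLaw e (stdComplexGaussian (Fin M)) P)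
    (heW : IndepFun e W P) (hW : AEMeasurable W P)
    (hW2 : Integrable (fun ω => sqNorm (W ω)) P) :
    ∫ ω, ‖star (e ω) ⬝ᵥ W ω‖ ^ 2 ∂P = ∫ ω, sqNorm (W ω) ∂P := by
  have hWm := memLp_two_apply_of_integrable_sqNorm hW hW2
  have hem := memLp_two_apply_of_hasLaw he
  have hterm : ∀ m, MemLp (fun ω => star (e ω m) * W ω m) 2 P := fun m =>
    memLp_two_mul_of_indepFun (hem m).star (hWm m)
      (heW.comp (φ := fun x : Fin M → ℂ => star (x m)) (ψ := fun x : Fin M → ℂ => x m)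
        (by fun_prop) (by fun_prop))
  have hcov : ∀ i j, ∫ ω, star (e ω i) * W ω i * conj (star (e ω j) * W ω j) ∂P =
      if j = i then ∫ ω, W ω i * conj (W ω j) ∂P else 0 := by
    intro i j
    have hind : IndepFun (fun ω => e ω j * conj (e ω i)) (fun ω => W ω i * conj (W ω j)) P :=
      heW.comp (φ := fun x : Fin M → ℂ => x j * conj (x i))
        (ψ := fun x : Fin M → ℂ => x i * conj (x j)) (by fun_prop) (by fun_prop)
    have hgauss := he.integral_comp (f := fun x : Fin M → ℂ => x j * conj (x i)) (by fun_prop)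
    rw [integral_apply_mul_conj_stdComplexGaussian, Function.comp_def] at hgauss
    calc ∫ ω, star (e ω i) * W ω i * conj (star (e ω j) * W ω j) ∂P
        = ∫ ω, e ω j * conj (e ω i) * (W ω i * conj (W ω j)) ∂P := by
          simp only [RCLike.star_def, map_mul, Complex.conj_conj]
          congr 1 with ω
          ring
      _ = _ := by
          rw [hind.integral_fun_mul_eq_mul_integral ((hem j).1.mul (hem i).star.1)
            ((hWm i).1.mul (hWm j).star.1), hgauss, ite_mul, one_mul, zero_mul]
  have hsum := integral_norm_sq_sum (s := Finset.univ) fun m _ => hterm m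
  simp_rw [hcov, Finset.sum_ite_eq', Finset.mem_univ, if_true, ← ofReal_integral_norm_sq] at hsum
  simp_rw [sqNorm]
  rw [integral_finsetSum _ fun m _ => (hWm m).integrable_norm_pow two_ne_zero]
  exact_mod_cast hsum

end GaussianInner

section Ppzf

variable {M : ℕ} {κ : Type*} [DecidableEq κ] {S : Finset κ} {t o : κ}

/-- The unnormalized PPZF precoding vector towards user `t`, computed from the channel estimates
`x`, when the users in `S` are the strong ones. -/
def ppzfVec (S : Finset κ) (t : κ) (x : κ → Fin M → ℂ) : Fin M → ℂ :=
  if ht : t ∈ S then pinv (colMat fun i : S => x i) *ᵥ Pi.single ⟨t, ht⟩ 1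
  else orthProj (colMat fun i : S => x i) *ᵥ x t

lemma ppzfVec_of_mem (ht : t ∈ S) (x : κ → Fin M → ℂ) :
    ppzfVec S t x = pinv (colMat fun i : S => x i) *ᵥ Pi.single ⟨t, ht⟩ 1 :=
  dif_pos ht

lemma ppzfVec_of_notMem (ht : t ∉ S) (x : κ → Fin M → ℂ) :
    ppzfVec S t x = orthProj (colMat fun i : S => x i) *ᵥ x t :=
  dif_neg ht

lemma measurable_ppzfVec (S : Finset κ) (t : κ) :
    Measurable fun x : κ → Fin M → ℂ => ppzfVec S t x := by
  have hcol : ∀ m (i : S), Measurable fun x : κ → Fin M → ℂ => colMat (fun i : S => x i) m i := by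
    intro m i
    simp only [colMat, Matrix.transpose_apply, Matrix.of_apply]
    fun_prop
  by_cases ht : t ∈ S
  · simp only [ppzfVec_of_mem ht]
    exact measurable_mulVec (measurable_pinv_apply hcol) measurable_const
  · simp only [ppzfVec_of_notMem ht]
    exact measurable_mulVec (measurable_orthProj_apply hcol) (measurable_pi_apply t)

lemma ppzfVec_update (ho : o ∉ S) (hto : t ≠ o) (x : κ → Fin M → ℂ) (v : Fin M → ℂ) :
    ppzfVec S t (Function.update x o v) = ppzfVec S t x := by
  have hcol : (fun i : S => Function.update x o v i) = fun i : S => x i :=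
    funext fun i => Function.update_of_ne (fun hi : ↑i = o => ho (hi ▸ i.2)) _ _
  rw [ppzfVec, ppzfVec, hcol, Function.update_of_ne hto]

lemma ppzfVec_ofReal_smul {c : κ → ℝ} (hc : ∀ k, c k ≠ 0) (x : κ → Fin M → ℂ) :
    ppzfVec S t (fun k => (c k : ℂ) • x k) =
      ((if t ∈ S then (c t)⁻¹ else c t : ℝ) : ℂ) • ppzfVec S t x := by
  have hcol : colMat (fun i : S => (c i : ℂ) • x i) =
      colMat (fun i : S => x i) * Matrix.diagonal fun i : S => (c i : ℂ) := by
    ext m i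
    simp [colMat, mul_comm]
  have hd : ∀ i : S, (c i : ℂ) ≠ 0 := fun i => Complex.ofReal_ne_zero.2 (hc i)
  split_ifs with ht
  · rw [ppzfVec_of_mem ht, ppzfVec_of_mem ht, hcol, pinv_mul_diagonal _ hd,
      ← Matrix.mulVec_mulVec, ← Matrix.mulVec_smul, Matrix.diagonal_mulVec_single,
      ← Pi.single_smul]
    simp
  · rw [ppzfVec_of_notMem ht, ppzfVec_of_notMem ht, hcol, orthProj_mul_diagonal _ hd,
      Matrix.mulVec_smul]

variable {x : κ → Fin M → ℂ}

lemma star_dotProduct_ppzfVec_of_mem (hx : LinearIndependent ℂ fun i : S => x i) (ho : o ∈ S)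
    (t : κ) : star (x o) ⬝ᵥ ppzfVec S t x = if t = o then 1 else 0 := by
  have hcol : LinearIndependent ℂ (colMat fun i : S => x i).col := hx
  change ((colMat fun i : S => x i)ᴴ *ᵥ ppzfVec S t x) ⟨o, ho⟩ = _
  by_cases ht : t ∈ S
  · rw [ppzfVec_of_mem ht, Matrix.mulVec_mulVec, conjTranspose_mul_pinv hcol, Matrix.one_mulVec]
    simp [Pi.single_apply, eq_comm]
  · rw [ppzfVec_of_notMem ht, Matrix.mulVec_mulVec, conjTranspose_mul_orthProj hcol,
      Matrix.zero_mulVec, if_neg fun h : t = o => ht (h ▸ ho), Pi.zero_apply]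

lemma star_dotProduct_ppzfVec_self_of_notMem (hx : LinearIndependent ℂ fun i : S => x i)
    (ho : o ∉ S) : star (x o) ⬝ᵥ ppzfVec S o x = sqNorm (ppzfVec S o x) := by
  rw [ppzfVec_of_notMem ho, star_dotProduct_orthProj_mulVec_self (H := colMat _) hx]

end Ppzf

section Normalize

variable {Ω : Type*} [MeasurableSpace Ω] {P : Measure Ω} {M : ℕ} {V : Ω → Fin M → ℂ}

lemma sqNorm_normalize (V : Ω → Fin M → ℂ) (ω : Ω) :
    sqNorm (normalize P V ω) = (∫ ω', sqNorm (V ω') ∂P)⁻¹ * sqNorm (V ω) := by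
  rw [normalize, sqNorm_smul, Complex.norm_real, Real.norm_eq_abs, sq_abs, inv_pow,
    Real.sq_sqrt (integral_nonneg fun ω => sqNorm_nonneg _)]

lemma integrable_sqNorm_normalize (hV : Integrable (fun ω => sqNorm (V ω)) P) :
    Integrable (fun ω => sqNorm (normalize P V ω)) P := by
  simp_rw [sqNorm_normalize]
  exact hV.const_mul _

lemma integral_sqNorm_normalize (hV : ∫ ω, sqNorm (V ω) ∂P ≠ 0) :
    ∫ ω, sqNorm (normalize P V ω) ∂P = 1 := by
  simp_rw [sqNorm_normalize]
  rw [integral_const_mul, inv_mul_cancel₀ hV]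

lemma aemeasurable_normalize (hV : AEMeasurable V P) : AEMeasurable (normalize P V) P :=
  (measurable_const_smul _).comp_aemeasurable hV

lemma normalize_ofReal_smul {a : ℝ} (ha : 0 < a) (V : Ω → Fin M → ℂ) :
    normalize P (fun ω => (a : ℂ) • V ω) = normalize P V := by
  ext1 ω
  simp_rw [normalize, sqNorm_smul, Complex.norm_real, Real.norm_eq_abs, sq_abs]
  rw [integral_const_mul, Real.sqrt_mul (sq_nonneg a), Real.sqrt_sq ha.le, smul_smul,
    ← Complex.ofReal_mul, mul_inv_rev, mul_assoc, inv_mul_cancel₀ ha.ne', mul_one]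

end Normalize

section Precoder

variable {Ω : Type*} [MeasurableSpace Ω] {P : Measure Ω} {M : ℕ} {κ : Type*} [DecidableEq κ]

/-- The PPZF precoder towards user `t` with strong users `S`, for the channel estimates `x`. -/
def precoder (P : Measure Ω) (S : Finset κ) (t : κ) (x : κ → Ω → Fin M → ℂ) : Ω → Fin M → ℂ :=
  normalize P fun ω => ppzfVec S t fun k => x k ω

lemma precoder_ofReal_smul {c : κ → ℝ} (hc : ∀ k, 0 < c k) (S : Finset κ) (t : κ)
    (x : κ → Ω → Fin M → ℂ) :
    precoder P S t (fun k ω => (c k : ℂ) • x k ω) = precoder P S t x := by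
  have hpos : 0 < if t ∈ S then (c t)⁻¹ else c t := by
    have := hc t
    split_ifs <;> positivity
  simp_rw [precoder, ppzfVec_ofReal_smul fun k => (hc k).ne', normalize_ofReal_smul hpos]

end Precoder

namespace IsStdGaussianFamily

variable {Ω : Type*} [MeasurableSpace Ω] {P : Measure Ω} {M : ℕ}
  {κ : Type*} [DecidableEq κ] {x : κ → Ω → Fin M → ℂ} {S : Finset κ} {t o : κ}

lemma hasLaw_sqNorm_ppzfVec (h : IsStdGaussianFamily P x) (hS : S.card < M) (ht : t ∉ S) :
    HasLaw (fun ω => sqNorm (ppzfVec S t fun k => x k ω)) (gammaMeasure (M - S.card : ℕ) 1) P := by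
  have hlaw := h.hasLaw_sqNorm_orthProj (f := (Subtype.val : S → κ)) Subtype.val_injective
    (by rwa [Fintype.card_coe]) (k := t) (by simpa using ht)
  rw [Fintype.card_coe] at hlaw
  simpa only [ppzfVec_of_notMem ht] using hlaw

lemma hasLaw_inv_sqNorm_ppzfVec (h : IsStdGaussianFamily P x) (hS : S.card < M) (ht : t ∈ S) :
    HasLaw (fun ω => (sqNorm (ppzfVec S t fun k => x k ω))⁻¹)
      (gammaMeasure ((M - S.card : ℕ) + 1) 1) P := by
  have hcard : Fintype.card {i : S // i ≠ ⟨t, ht⟩} = S.card - 1 := by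
    rw [Fintype.card_subtype_compl, Fintype.card_subtype_eq, Fintype.card_coe]
  have hpos : 0 < S.card := Finset.card_pos.2 ⟨t, ht⟩
  have hlaw := h.hasLaw_sqNorm_orthProj (f := fun i : {i : S // i ≠ ⟨t, ht⟩} => (i : κ))
    (Subtype.val_injective.comp Subtype.val_injective) (by lia) (k := t) (by simp)
  rw [hcard, show M - (S.card - 1) = M - S.card + 1 by lia, Nat.cast_add_one] at hlaw
  refine hlaw.congr ?_
  filter_upwards [h.ae_linearIndepOn S hS.le] with ω hω
  have hcol : LinearIndependent ℂ (colMat fun i : S => x i ω).col := hω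
  rw [ppzfVec_of_mem ht, sqNorm_pinv_mulVec_single hcol, inv_inv]
  rfl

lemma memLp_two_sqNorm_ppzfVec (h : IsStdGaussianFamily P x) (hS : S.card < M) (ht : t ∉ S) :
    MemLp (fun ω => sqNorm (ppzfVec S t fun k => x k ω)) 2 P := by
  have hlaw := h.hasLaw_sqNorm_ppzfVec hS ht
  have hmem := memLp_two_id_gammaMeasure (Nat.cast_pos.2 (Nat.sub_pos_of_lt hS)) one_pos
  rw [← hlaw.map_eq] at hmem
  exact hmem.comp_of_map hlaw.aemeasurable

lemma integrable_sqNorm_ppzfVec (h : IsStdGaussianFamily P x) (hS : S.card < M) (t : κ) :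
    Integrable (fun ω => sqNorm (ppzfVec S t fun k => x k ω)) P := by
  have := h.indep.isProbabilityMeasure
  have hn : (0 : ℝ) < (M - S.card : ℕ) := Nat.cast_pos.2 (Nat.sub_pos_of_lt hS)
  by_cases ht : t ∈ S
  · have hlaw := h.hasLaw_inv_sqNorm_ppzfVec hS ht
    have hint := integrable_inv_gammaMeasure (lt_add_of_pos_left 1 hn) one_pos
    rw [← hlaw.map_eq] at hint
    simpa only [Function.comp_def, inv_inv] using hint.comp_aemeasurable hlaw.aemeasurable
  · exact (h.memLp_two_sqNorm_ppzfVec hS ht).integrable one_le_two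

lemma integral_sqNorm_ppzfVec (h : IsStdGaussianFamily P x) (hS : S.card < M) (t : κ) :
    ∫ ω, sqNorm (ppzfVec S t fun k => x k ω) ∂P =
      if t ∈ S then ((M - S.card : ℕ) : ℝ)⁻¹ else (M - S.card : ℕ) := by
  have hn : (0 : ℝ) < (M - S.card : ℕ) := Nat.cast_pos.2 (Nat.sub_pos_of_lt hS)
  split_ifs with ht
  · have hlaw := (h.hasLaw_inv_sqNorm_ppzfVec hS ht).integral_comp (f := fun y => y⁻¹)
      measurable_inv.aestronglyMeasurable
    rw [integral_inv_gammaMeasure (lt_add_of_pos_left 1 hn) one_pos, add_sub_cancel_right,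
      one_div] at hlaw
    simpa only [Function.comp_def, inv_inv] using hlaw
  · rw [(h.hasLaw_sqNorm_ppzfVec hS ht).integral_eq, integral_id_gammaMeasure hn one_pos, div_one]

lemma integral_sqNorm_ppzfVec_sq (h : IsStdGaussianFamily P x) (hS : S.card < M) (ht : t ∉ S) :
    ∫ ω, sqNorm (ppzfVec S t fun k => x k ω) ^ 2 ∂P =
      (M - S.card : ℕ) * ((M - S.card : ℕ) + 1) := by
  have hlaw := (h.hasLaw_sqNorm_ppzfVec hS ht).integral_comp (f := fun y => y ^ 2) (by fun_prop)
  rw [integral_sq_gammaMeasure (Nat.cast_pos.2 (Nat.sub_pos_of_lt hS)) one_pos, one_pow,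
    div_one] at hlaw
  exact hlaw

section Precoder

variable (h : IsStdGaussianFamily P x) (hS : S.card < M)
include h hS

lemma integrable_sqNorm_precoder (t : κ) :
    Integrable (fun ω => sqNorm (precoder P S t x ω)) P :=
  integrable_sqNorm_normalize (h.integrable_sqNorm_ppzfVec hS t)

lemma integral_sqNorm_precoder (t : κ) : ∫ ω, sqNorm (precoder P S t x ω) ∂P = 1 := by
  refine integral_sqNorm_normalize ?_
  have hn : M - S.card ≠ 0 := (Nat.sub_pos_of_lt hS).ne'
  rw [h.integral_sqNorm_ppzfVec hS]
  split_ifs <;> positivity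

lemma star_dotProduct_precoder_ae_eq_of_mem (ho : o ∈ S) (t : κ) :
    (fun ω => star (x o ω) ⬝ᵥ precoder P S t x ω) =ᵐ[P]
      fun _ => ((if t = o then √(M - S.card : ℕ) else 0 : ℝ) : ℂ) := by
  filter_upwards [h.ae_linearIndepOn S hS.le] with ω hω
  rw [precoder, normalize, dotProduct_smul, h.integral_sqNorm_ppzfVec hS,
    star_dotProduct_ppzfVec_of_mem (x := fun k => x k ω) hω ho]
  by_cases hto : t = o
  · rw [hto, if_pos ho, if_pos rfl, if_pos rfl, Real.sqrt_inv, inv_inv, smul_eq_mul, mul_one]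
  · rw [if_neg hto, if_neg hto, smul_zero, Complex.ofReal_zero]

lemma star_dotProduct_precoder_self_ae_eq_of_notMem (ho : o ∉ S) :
    (fun ω => star (x o ω) ⬝ᵥ precoder P S o x ω) =ᵐ[P]
      fun ω => (((√(M - S.card : ℕ))⁻¹ * sqNorm (ppzfVec S o fun k => x k ω) : ℝ) : ℂ) := by
  filter_upwards [h.ae_linearIndepOn S hS.le] with ω hω
  rw [precoder, normalize, dotProduct_smul, h.integral_sqNorm_ppzfVec hS, if_neg ho,
    star_dotProduct_ppzfVec_self_of_notMem (x := fun k => x k ω) hω ho, smul_eq_mul,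
    Complex.ofReal_mul]

variable [Finite κ]

omit hS in
lemma aemeasurable_precoder (t : κ) : AEMeasurable (precoder P S t x) P :=
  aemeasurable_normalize ((measurable_ppzfVec S t).comp_aemeasurable (f := fun ω k => x k ω)
    (aemeasurable_pi_lambda _ fun k => (h.law k).aemeasurable))

omit hS in
lemma indepFun_precoder (ho : o ∉ S) (hto : t ≠ o) : IndepFun (x o) (precoder P S t x) P := by
  let extend (q : {k // k ≠ o} → Fin M → ℂ) (k : κ) : Fin M → ℂ :=
    if hk : k = o then 0 else q ⟨k, hk⟩
  have hextend : Measurable extend := by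
    refine measurable_pi_lambda _ fun k => ?_
    by_cases hk : k = o
    · simp only [extend, dif_pos hk, measurable_const]
    · simp only [extend, dif_neg hk, measurable_pi_apply]
  have hind : IndepFun (fun ω (k : {k // k ≠ o}) => x k ω) (x o) P :=
    h.indepFun_of_notMem_range (by simp)
  have hppzf := hind.symm.comp measurable_id
    ((measurable_const_smul (((√(∫ ω, sqNorm (ppzfVec S t fun k => x k ω) ∂P))⁻¹ : ℝ) : ℂ)).comp
      ((measurable_ppzfVec S t).comp hextend))
  refine hppzf.congr .rfl (.of_forall fun ω => ?_)
  simp only [precoder, normalize, Function.comp_apply]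
  rw [← ppzfVec_update ho hto (fun k => x k ω) 0]
  congr 2
  ext1 k
  by_cases hk : k = o <;> simp [extend, hk]

lemma memLp_two_star_dotProduct_precoder (o t : κ) :
    MemLp (fun ω => star (x o ω) ⬝ᵥ precoder P S t x ω) 2 P := by
  have := h.indep.isProbabilityMeasure
  by_cases ho : o ∈ S
  · exact (memLp_congr_ae (h.star_dotProduct_precoder_ae_eq_of_mem hS ho t)).2 (memLp_const _)
  by_cases hto : t = o
  · subst hto
    exact (memLp_congr_ae (h.star_dotProduct_precoder_self_ae_eq_of_notMem hS ho)).2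
      ((h.memLp_two_sqNorm_ppzfVec hS ho).const_mul _).ofReal
  · exact memLp_two_star_dotProduct (h.law o) (h.indepFun_precoder ho hto)
      (h.aemeasurable_precoder t) (h.integrable_sqNorm_precoder hS t)

lemma integral_star_dotProduct_precoder (o t : κ) :
    ∫ ω, star (x o ω) ⬝ᵥ precoder P S t x ω ∂P =
      ((if t = o then √(M - S.card : ℕ) else 0 : ℝ) : ℂ) := by
  have := h.indep.isProbabilityMeasure
  by_cases ho : o ∈ S
  · rw [integral_congr_ae (h.star_dotProduct_precoder_ae_eq_of_mem hS ho t), integral_const,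
      probReal_univ, one_smul]
  by_cases hto : t = o
  · subst hto
    rw [integral_congr_ae (h.star_dotProduct_precoder_self_ae_eq_of_notMem hS ho),
      integral_complex_ofReal, integral_const_mul, h.integral_sqNorm_ppzfVec hS, if_neg ho,
      if_pos rfl, inv_mul_eq_div, Real.div_sqrt]
  · have hmean := integral_star_dotProduct_mul (A := fun _ => 1) (h.law o)
      ((h.indepFun_precoder ho hto).comp measurable_id (measurable_id.prodMk measurable_const))
      (h.aemeasurable_precoder t) (h.integrable_sqNorm_precoder hS t) (memLp_const 1)
    simpa only [mul_one, id, if_neg hto, Complex.ofReal_zero] using hmean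

lemma integral_norm_sq_star_dotProduct_precoder (o t : κ) :
    ∫ ω, ‖star (x o ω) ⬝ᵥ precoder P S t x ω‖ ^ 2 ∂P =
      (if t = o then ((M - S.card : ℕ) : ℝ) else 0) + if o ∈ S then 0 else 1 := by
  have := h.indep.isProbabilityMeasure
  have hn : (0 : ℝ) < (M - S.card : ℕ) := Nat.cast_pos.2 (Nat.sub_pos_of_lt hS)
  by_cases ho : o ∈ S
  · rw [integral_congr_ae ((h.star_dotProduct_precoder_ae_eq_of_mem hS ho t).mono
      fun ω hω => congrArg (‖·‖ ^ 2) hω), integral_const, probReal_univ, one_smul, if_pos ho,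
      add_zero]
    split_ifs <;> simp
  by_cases hto : t = o
  · subst hto
    rw [integral_congr_ae ((h.star_dotProduct_precoder_self_ae_eq_of_notMem hS ho).mono
      fun ω hω => congrArg (‖·‖ ^ 2) hω)]
    simp_rw [Complex.norm_real, Real.norm_eq_abs, sq_abs, mul_pow, inv_pow, Real.sq_sqrt hn.le]
    rw [integral_const_mul, h.integral_sqNorm_ppzfVec_sq hS ho, inv_mul_cancel_left₀ hn.ne',
      if_pos trivial, if_neg ho]
  · rw [integral_norm_sq_star_dotProduct (h.law o) (h.indepFun_precoder ho hto)
      (h.aemeasurable_precoder t) (h.integrable_sqNorm_precoder hS t),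
      h.integral_sqNorm_precoder hS, if_neg hto, if_neg ho, zero_add]

end Precoder

end IsStdGaussianFamily

lemma star_add_smul_dotProduct {M : ℕ} (a b : ℝ) (x y W : Fin M → ℂ) :
    star ((a : ℂ) • x + (b : ℂ) • y) ⬝ᵥ W = a * (star x ⬝ᵥ W) + b * (star y ⬝ᵥ W) := by
  simp only [star_add, star_smul, add_dotProduct, smul_dotProduct, smul_eq_mul, RCLike.star_def,
    Complex.conj_ofReal]

namespace IsStdGaussianFamily

section ExtraVector

variable {Ω : Type*} [MeasurableSpace Ω] {P : Measure Ω} {M : ℕ} {κ : Type*}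
  {z : Option κ → Ω → Fin M → ℂ} {S : Finset κ}

lemma precomp {ι α β : Type*} [Fintype ι] {y : β → Ω → ι → ℂ} (h : IsStdGaussianFamily P y)
    {f : α → β} (hf : Function.Injective f) : IsStdGaussianFamily P fun i => y (f i) :=
  ⟨h.indep.precomp hf, fun i => h.law (f i)⟩

variable [Finite κ] [DecidableEq κ]

lemma indepFun_none_precoder (h : IsStdGaussianFamily P z) (o t : κ) :
    IndepFun (z none) (fun ω => (precoder P S t (fun k => z (some k)) ω,
      conj (star (z (some o) ω) ⬝ᵥ precoder P S t (fun k => z (some k)) ω))) P := by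
  have hind : IndepFun (z none) (fun ω k => z (some k) ω) P :=
    (h.indepFun_of_notMem_range (f := some) (by simp)).symm
  let W (q : κ → Fin M → ℂ) : Fin M → ℂ :=
    (((√(∫ ω, sqNorm (ppzfVec S t fun k => z (some k) ω) ∂P))⁻¹ : ℝ) : ℂ) • ppzfVec S t q
  have hW : Measurable W := (measurable_const_smul _).comp (measurable_ppzfVec S t)
  have hWo : Measurable fun q => conj (star (q o) ⬝ᵥ W q) := by
    refine Complex.continuous_conj.measurable.comp (Finset.measurable_sum _ fun m _ => ?_)
    exact Measurable.mul (f := fun q : κ → Fin M → ℂ => star (q o) m) (by fun_prop)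
      ((measurable_pi_apply m).comp hW)
  exact hind.comp (φ := id) (ψ := fun q => (W q, conj (star (q o) ⬝ᵥ W q))) measurable_id
    (hW.prodMk hWo)

variable (h : IsStdGaussianFamily P z) (hS : S.card < M)
  (a b : ℝ) (o t : κ)

include h hS

lemma memLp_two_star_none_dotProduct_precoder :
    MemLp (fun ω => star (z none ω) ⬝ᵥ precoder P S t (fun k => z (some k)) ω) 2 P := by
  have hsome := h.precomp (Option.some_injective κ)
  exact memLp_two_star_dotProduct (h.law none)
    ((h.indepFun_none_precoder t t).comp measurable_id measurable_fst)
    (hsome.aemeasurable_precoder t) (hsome.integrable_sqNorm_precoder hS t)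

lemma integral_norm_sq_star_none_dotProduct_precoder :
    ∫ ω, ‖star (z none ω) ⬝ᵥ precoder P S t (fun k => z (some k)) ω‖ ^ 2 ∂P = 1 := by
  have hsome := h.precomp (Option.some_injective κ)
  exact (integral_norm_sq_star_dotProduct (h.law none)
    ((h.indepFun_none_precoder t t).comp measurable_id measurable_fst)
    (hsome.aemeasurable_precoder t) (hsome.integrable_sqNorm_precoder hS t)).trans
    (hsome.integral_sqNorm_precoder hS t)

lemma memLp_two_star_add_smul_dotProduct_precoder :
    MemLp (fun ω => star ((a : ℂ) • z (some o) ω + (b : ℂ) • z none ω) ⬝ᵥ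
      precoder P S t (fun k => z (some k)) ω) 2 P := by
  simp_rw [star_add_smul_dotProduct]
  exact (((h.precomp (Option.some_injective κ)).memLp_two_star_dotProduct_precoder hS o t).const_mul
    _).add ((h.memLp_two_star_none_dotProduct_precoder hS t).const_mul _)

lemma integral_star_add_smul_dotProduct_precoder :
    ∫ ω, star ((a : ℂ) • z (some o) ω + (b : ℂ) • z none ω) ⬝ᵥ
      precoder P S t (fun k => z (some k)) ω ∂P =
      ((if t = o then a * √(M - S.card : ℕ) else 0 : ℝ) : ℂ) := by
  have := h.indep.isProbabilityMeasure
  have hsome := h.precomp (Option.some_injective κ)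
  have hnone := integral_star_dotProduct_mul (A := fun _ => 1) (h.law none)
    ((h.indepFun_none_precoder t t).comp measurable_id (measurable_fst.prodMk measurable_const))
    (hsome.aemeasurable_precoder t) (hsome.integrable_sqNorm_precoder hS t) (memLp_const 1)
  simp only [mul_one] at hnone
  simp_rw [star_add_smul_dotProduct]
  rw [integral_add
      (((hsome.memLp_two_star_dotProduct_precoder hS o t).integrable one_le_two).const_mul _)
      (((h.memLp_two_star_none_dotProduct_precoder hS t).integrable one_le_two).const_mul _),
    integral_const_mul, integral_const_mul, hnone, hsome.integral_star_dotProduct_precoder hS]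
  split_ifs <;> simp

lemma integral_norm_sq_star_add_smul_dotProduct_precoder :
    ∫ ω, ‖star ((a : ℂ) • z (some o) ω + (b : ℂ) • z none ω) ⬝ᵥ
      precoder P S t (fun k => z (some k)) ω‖ ^ 2 ∂P =
      (if t = o then a ^ 2 * (M - S.card : ℕ) else 0) + (if o ∈ S then 0 else a ^ 2) + b ^ 2 := by
  have hsome := h.precomp (Option.some_injective κ)
  have hm := hsome.memLp_two_star_dotProduct_precoder hS o t
  have hcross := integral_star_dotProduct_mul (h.law none) (h.indepFun_none_precoder o t)
    (hsome.aemeasurable_precoder t) (hsome.integrable_sqNorm_precoder hS t) hm.star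
  simp_rw [star_add_smul_dotProduct, add_comm (_ * _ : ℂ) (b * _)]
  rw [integral_norm_sq_add ((h.memLp_two_star_none_dotProduct_precoder hS t).const_mul _)
    (hm.const_mul _)]
  · simp_rw [norm_mul, mul_pow, Complex.norm_real, Real.norm_eq_abs, sq_abs]
    rw [integral_const_mul, integral_const_mul,
      h.integral_norm_sq_star_none_dotProduct_precoder hS,
      hsome.integral_norm_sq_star_dotProduct_precoder hS]
    split_ifs <;> ring
  · simp_rw [map_mul, Complex.conj_ofReal, mul_mul_mul_comm]
    rw [integral_const_mul, hcross, mul_zero]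

end ExtraVector

end IsStdGaussianFamily

section Blocks

variable {Ω : Type*} [MeasurableSpace Ω] {P : Measure Ω} {ι α β : Type*} [Fintype ι] [Fintype α]
  [Fintype β]

lemma hasLaw_stdComplexGaussian_iff [IsProbabilityMeasure P] {X : ι → Ω → ℂ} :
    HasLaw (fun ω i => X i ω) (stdComplexGaussian ι) P ↔
      iIndepFun X P ∧ ∀ i, HasLaw (X i) (complexGaussian 1) P := by
  refine ⟨fun h => ?_, fun h => h.1.hasLaw_pi h.2⟩
  have hX := fun i => (hasLaw_eval_stdComplexGaussian i).fun_comp h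
  exact ⟨(iIndepFun_iff_hasLaw_pi_pi hX).2 h, hX⟩

lemma hasLaw_precomp_stdComplexGaussian {X : Ω → ι → ℂ} (hX : HasLaw X (stdComplexGaussian ι) P)
    {f : α → ι} (hf : Function.Injective f) :
    HasLaw (fun ω a => X ω (f a)) (stdComplexGaussian α) P := by
  have : IsProbabilityMeasure P := hX.isProbabilityMeasure
  obtain ⟨hind, hlaw⟩ := hasLaw_stdComplexGaussian_iff.1 hX
  exact hasLaw_stdComplexGaussian_iff.2 ⟨hind.precomp hf, fun a => hlaw (f a)⟩

lemma isStdGaussianFamily_iff_hasLaw_pi [IsProbabilityMeasure P] {z : α → Ω → ι → ℂ} :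
    IsStdGaussianFamily P z ↔
      HasLaw (fun ω a => z a ω) (Measure.pi fun _ => stdComplexGaussian ι) P := by
  refine ⟨fun h => h.indep.hasLaw_pi h.law, fun h => ?_⟩
  have hz := fun a => (measurePreserving_eval (fun _ => stdComplexGaussian ι) a).fun_comp_hasLaw h
  exact ⟨(iIndepFun_iff_hasLaw_pi_pi hz).2 h, hz⟩

lemma isStdGaussianFamily_curry_iff [IsProbabilityMeasure P] {X : Ω → α × β → ℂ} :
    IsStdGaussianFamily P (fun a ω b => X ω (a, b)) ↔
      HasLaw X (stdComplexGaussian (α × β)) P := by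
  have hcurry : HasLaw (MeasurableEquiv.curry α β ℂ) (Measure.pi fun _ => stdComplexGaussian β)
      (stdComplexGaussian (α × β)) := by
    refine ⟨by fun_prop, ?_⟩
    simp_rw [stdComplexGaussian, ← Measure.infinitePi_eq_pi]
    exact Measure.infinitePi_map_curry fun _ _ => complexGaussian 1
  have huncurry : HasLaw (MeasurableEquiv.curry α β ℂ).symm (stdComplexGaussian (α × β))
      (Measure.pi fun _ => stdComplexGaussian β) := by
    refine ⟨by fun_prop, ?_⟩
    rw [← hcurry.map_eq, MeasurableEquiv.map_symm_map]
  rw [isStdGaussianFamily_iff_hasLaw_pi]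
  exact ⟨huncurry.comp, hcurry.comp⟩

end Blocks

lemma IsStdGaussianFamily.mulVec {Ω α ι κ : Type*} [MeasurableSpace Ω]
    {P : Measure Ω} [Fintype ι] [Fintype κ] [DecidableEq κ] {z : α → Ω → ι → ℂ}
    (h : IsStdGaussianFamily P z) {C : α → Matrix κ ι ℂ} (hC : ∀ a, C a * (C a)ᴴ = 1) :
    IsStdGaussianFamily P fun a ω => C a *ᵥ z a ω :=
  ⟨h.indep.comp (fun a x => C a *ᵥ x) fun a => by fun_prop,
    fun a => (hasLaw_mulVec_stdComplexGaussian (hC a)).fun_comp (h.law a)⟩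

section Whitening

variable {L K M τ : ℕ} [NeZero K]

/-- The correlation coefficient between the eavesdropper's fading `g_{l,E}` and the normalized
estimate of the channel of user `0`. -/
def eveCorr (p : Params L K M τ) (l : Fin L) : ℝ := √(τ * p.ρE * p.βE l / pilotVar p l 0)

/-- The coefficients of the normalized projected pilot signal `v_{l,k}^(-1/2) Y_l φ_k`, at any
antenna, with respect to the fading of the users, the fading of the eavesdropper and the noise
at that antenna. -/
def estRow (p : Params L K M τ) (l : Fin L) (k : Fin K) : Fin K ⊕ Unit ⊕ Fin τ → ℂ :=
  Sum.elim (Pi.single k (√(τ * p.ρu * p.β l k / pilotVar p l k) : ℂ))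
    (Sum.elim (fun _ => if k = 0 then (eveCorr p l : ℂ) else 0)
      ((√(pilotVar p l k)⁻¹ : ℂ) • p.φ k))

/-- The coefficients of the normalized error of the linear MMSE estimate of the eavesdropper's
fading from the pilot signal. -/
def errRow (p : Params L K M τ) (l : Fin L) : Fin K ⊕ Unit ⊕ Fin τ → ℂ :=
  (((√(1 - eveCorr p l ^ 2))⁻¹ : ℝ) : ℂ) •
    (Pi.single (.inr (.inl ())) 1 - (eveCorr p l : ℂ) • estRow p l 0)

/-- The matrix turning the random entries at an antenna of AP `l` into the uncorrelated normalized
estimates `some k` of the channels of the users and the error `none` of the estimate of the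
eavesdropper's channel. -/
def whitening (p : Params L K M τ) (l : Fin L) :
    Matrix (Option (Fin K)) (Fin K ⊕ Unit ⊕ Fin τ) ℂ :=
  Matrix.of fun o => o.elim (errRow p l) (estRow p l)

variable {p : Params L K M τ} (hp : p.Admissible) (l : Fin L)
include hp

lemma Params.Admissible.pilotVar_pos (k : Fin K) : 0 < pilotVar p l k := by
  have hβ := hp.β_pos l k
  have hβE := hp.βE_nonneg l
  have hρu := hp.ρu_pos
  have hρE := hp.ρE_nonneg
  unfold pilotVar
  split_ifs <;> positivity

lemma Params.Admissible.eveCorr_sq :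
    eveCorr p l ^ 2 = τ * p.ρE * p.βE l / pilotVar p l 0 := by
  have hβE := hp.βE_nonneg l
  have hρE := hp.ρE_nonneg
  have hv := hp.pilotVar_pos l 0
  exact Real.sq_sqrt (by positivity)

lemma Params.Admissible.eveCorr_sq_lt_one : eveCorr p l ^ 2 < 1 := by
  have hβ := hp.β_pos l 0
  have hρu := hp.ρu_pos
  rw [hp.eveCorr_sq, div_lt_one (hp.pilotVar_pos l 0), pilotVar, if_pos rfl]
  have hsignal : 0 ≤ τ * p.ρu * p.β l 0 := by positivity
  linarith

lemma Params.Admissible.div_pilotVar_add_eq_one (k : Fin K) :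
    τ * p.ρu * p.β l k / pilotVar p l k +
      ((if k = 0 then eveCorr p l ^ 2 else 0) + (pilotVar p l k)⁻¹) = 1 := by
  have hv := (hp.pilotVar_pos l k).ne'
  split_ifs with hk
  · subst hk
    rw [hp.eveCorr_sq]
    field_simp
    rw [pilotVar, if_pos rfl]
    ring
  · field_simp
    rw [pilotVar, if_neg hk]
    ring

lemma Params.Admissible.estRow_dotProduct_star (k k' : Fin K) :
    estRow p l k ⬝ᵥ star (estRow p l k') = if k = k' then 1 else 0 := by
  have hpilot : p.φ k ⬝ᵥ star (p.φ k') = if k = k' then 1 else 0 := by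
    rw [dotProduct_comm, hp.pilots]
    simp only [eq_comm]
  rw [estRow, estRow, Function.star_sumElim, Function.star_sumElim, sumElim_dotProduct_sumElim,
    sumElim_dotProduct_sumElim, single_dotProduct, star_smul, smul_dotProduct, dotProduct_smul,
    hpilot]
  rcases eq_or_ne k k' with rfl | hk
  · have hβ := hp.β_pos l k
    have hρu := hp.ρu_pos
    have hv := hp.pilotVar_pos l k
    have hreal : √(τ * p.ρu * p.β l k / pilotVar p l k) * √(τ * p.ρu * p.β l k / pilotVar p l k) +
        ((if k = 0 then eveCorr p l * eveCorr p l else 0) +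
          √(pilotVar p l k)⁻¹ * √(pilotVar p l k)⁻¹) = 1 := by
      rw [Real.mul_self_sqrt (by positivity), Real.mul_self_sqrt (by positivity), ← pow_two,
        hp.div_pilotVar_add_eq_one]
    rw [if_pos rfl]
    refine Eq.trans ?_ ((congrArg Complex.ofReal hreal).trans Complex.ofReal_one)
    split_ifs <;> simp [dotProduct]
  · have hzero : ¬(k = 0 ∧ k' = 0) := fun h => hk (h.1.trans h.2.symm)
    simpa [dotProduct, hk] using fun h => .inr fun h' => absurd ⟨h, h'⟩ hzero

lemma Params.Admissible.errRow_dotProduct_star_estRow (k : Fin K) :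
    errRow p l ⬝ᵥ star (estRow p l k) = 0 := by
  rw [errRow, smul_dotProduct, sub_dotProduct, smul_dotProduct, hp.estRow_dotProduct_star,
    single_dotProduct]
  by_cases hk : k = 0 <;> simp [estRow, hk, eq_comm]

lemma Params.Admissible.errRow_dotProduct_star_self :
    errRow p l ⬝ᵥ star (errRow p l) = 1 := by
  have hc : 0 < 1 - eveCorr p l ^ 2 := sub_pos.2 (hp.eveCorr_sq_lt_one l)
  have hreal : (√(1 - eveCorr p l ^ 2))⁻¹ *
      ((√(1 - eveCorr p l ^ 2))⁻¹ * (1 - eveCorr p l * eveCorr p l)) = 1 := by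
    rw [← mul_assoc, ← mul_inv, Real.mul_self_sqrt hc.le, ← pow_two, inv_mul_cancel₀ hc.ne']
  have hentry : errRow p l (.inr (.inl ())) =
      (((√(1 - eveCorr p l ^ 2))⁻¹ * (1 - eveCorr p l * eveCorr p l) : ℝ) : ℂ) := by
    simp [errRow, estRow]
  nth_rw 2 [errRow]
  rw [star_smul, star_sub, star_smul, dotProduct_smul, dotProduct_sub, dotProduct_smul,
    hp.errRow_dotProduct_star_estRow, ← Pi.single_star, dotProduct_single, hentry, smul_zero,
    sub_zero, star_one, mul_one, RCLike.star_def, Complex.conj_ofReal, smul_eq_mul]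
  exact_mod_cast hreal

lemma Params.Admissible.whitening_mul_conjTranspose :
    whitening p l * (whitening p l)ᴴ = 1 := by
  ext (_ | k) (_ | k')
  · exact hp.errRow_dotProduct_star_self l
  · exact hp.errRow_dotProduct_star_estRow l k'
  · refine (Matrix.dotProduct_star _ _).trans ?_
    exact (congrArg star (hp.errRow_dotProduct_star_estRow l k)).trans (star_zero ℂ)
  · exact (hp.estRow_dotProduct_star l k k').trans (by simp [Matrix.one_apply])

end Whitening

section Whitened

variable {Ω : Type*} {L K M τ : ℕ}

/-- The i.i.d. entries seen at antenna `m` of AP `l`: the fading of the users, the fading of the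
eavesdropper and the pilot noise. -/
def antennaEntries (r : Randomness Ω L K M τ) (l : Fin L) (m : Fin M) (ω : Ω) :
    Fin K ⊕ Unit ⊕ Fin τ → ℂ :=
  Sum.elim (fun k => r.g l k m ω) (Sum.elim (fun _ => r.gE l m ω) fun j => r.N l m j ω)

variable [NeZero K]

/-- The normalized channel estimates `some k` of the users and the normalized error `none` of the
estimate of the eavesdropper's channel, at AP `l`. -/
def whitened (p : Params L K M τ) (r : Randomness Ω L K M τ) (l : Fin L) (o : Option (Fin K))
    (ω : Ω) : Fin M → ℂ :=
  fun m => (whitening p l *ᵥ antennaEntries r l m ω) o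

section Law

variable [MeasurableSpace Ω] {P : Measure Ω} {p : Params L K M τ} {r : Randomness Ω L K M τ}

omit [NeZero K] in
lemma Randomness.IsRayleigh.isStdGaussianFamily_antennaEntries (hr : r.IsRayleigh P) :
    IsStdGaussianFamily P fun a : Fin L × Fin M => antennaEntries r a.1 a.2 := by
  have := hr.indep.isProbabilityMeasure
  let f : (Fin L × Fin M) × (Fin K ⊕ Unit ⊕ Fin τ) →
      (Fin L × Fin K × Fin M) ⊕ (Fin L × Fin M) ⊕ (Fin L × Fin M × Fin τ)
    | (a, .inl k) => .inl (a.1, k, a.2)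
    | (a, .inr (.inl _)) => .inr (.inl a)
    | (a, .inr (.inr j)) => .inr (.inr (a.1, a.2, j))
  have hf : Function.Injective f := by
    rintro ⟨⟨l, m⟩, k | _ | j⟩ ⟨⟨l', m'⟩, k' | _ | j'⟩ h <;> simp_all [f]
  have hlaw := hasLaw_precomp_stdComplexGaussian
    (hasLaw_stdComplexGaussian_iff.2 ⟨hr.indep, hr.law⟩) hf
  convert isStdGaussianFamily_curry_iff.2 hlaw using 3 with a ω
  ext (k | _ | j) <;> rfl

lemma Params.Admissible.hasLaw_whitened (hp : p.Admissible) (hr : r.IsRayleigh P) :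
    HasLaw (fun ω (a : (Fin L × Fin M) × Option (Fin K)) => whitened p r a.1.1 a.2 ω a.1.2)
      (stdComplexGaussian ((Fin L × Fin M) × Option (Fin K))) P := by
  have := hr.indep.isProbabilityMeasure
  exact isStdGaussianFamily_curry_iff.1
    (hr.isStdGaussianFamily_antennaEntries.mulVec fun a => hp.whitening_mul_conjTranspose a.1)

lemma Params.Admissible.isStdGaussianFamily_whitened (hp : p.Admissible) (hr : r.IsRayleigh P)
    (l : Fin L) : IsStdGaussianFamily P (whitened p r l) := by
  have := hr.indep.isProbabilityMeasure
  have hf : Function.Injective fun a : Option (Fin K) × Fin M => ((l, a.2), a.1) := by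
    rintro ⟨o, m⟩ ⟨o', m'⟩ h
    simp_all
  exact isStdGaussianFamily_curry_iff.2
    (hasLaw_precomp_stdComplexGaussian (hp.hasLaw_whitened hr) hf)

lemma Params.Admissible.iIndepFun_whitened (hp : p.Admissible) (hr : r.IsRayleigh P) :
    iIndepFun (fun l ω (a : Option (Fin K) × Fin M) => whitened p r l a.1 ω a.2) P := by
  have := hr.indep.isProbabilityMeasure
  have hf : Function.Injective fun a : Fin L × Option (Fin K) × Fin M =>
      ((a.1, a.2.2), a.2.1) := by
    rintro ⟨l, o, m⟩ ⟨l', o', m'⟩ h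
    simp_all
  exact (isStdGaussianFamily_curry_iff.2
    (hasLaw_precomp_stdComplexGaussian (hp.hasLaw_whitened hr) hf)).indep

end Law

variable {p : Params L K M τ} (hp : p.Admissible) (r : Randomness Ω L K M τ) (l : Fin L)
include hp

lemma Params.Admissible.pilotMatrix_mulVec_apply (k : Fin K) (ω : Ω) (m : Fin M) :
    (pilotMatrix p r l ω *ᵥ p.φ k) m = √(τ * p.ρu) * (√(p.β l k) * r.g l k m ω) +
      (if k = 0 then √(τ * p.ρE) * (√(p.βE l) * r.gE l m ω) else 0) +
      p.φ k ⬝ᵥ fun j => r.N l m j ω := by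
  have hpilot (x : Fin M → ℂ) (k' : Fin K) : Matrix.vecMulVec x (star (p.φ k')) *ᵥ p.φ k =
      if k' = k then x else 0 := by
    rw [Matrix.vecMulVec_mulVec, hp.pilots]
    split_ifs <;> simp
  rw [pilotMatrix, Matrix.add_mulVec, Matrix.add_mulVec, Matrix.smul_mulVec, Matrix.smul_mulVec,
    Matrix.sum_mulVec, dotProduct_comm]
  simp_rw [hpilot, @eq_comm _ 0 k, Finset.sum_ite_eq' Finset.univ k]
  rw [if_pos (Finset.mem_univ k)]
  split_ifs <;> simp [Matrix.mulVec, h, hE]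

lemma Params.Admissible.pilotMatrix_mulVec (k : Fin K) (ω : Ω) :
    pilotMatrix p r l ω *ᵥ p.φ k = (√(pilotVar p l k) : ℂ) • whitened p r l (some k) ω := by
  have hv := hp.pilotVar_pos l k
  have hρu := hp.ρu_pos
  have hρE := hp.ρE_nonneg
  have hscale (x : ℝ) : √(pilotVar p l k) * √(x / pilotVar p l k) = √x := by
    rw [← Real.sqrt_mul hv.le, mul_div_cancel₀ _ hv.ne']
  have hg : (√(pilotVar p l k) : ℂ) * √(τ * p.ρu * p.β l k / pilotVar p l k) =
      √(τ * p.ρu) * √(p.β l k) := by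
    exact_mod_cast (hscale _).trans (Real.sqrt_mul (by positivity) _)
  have hgE (hk : k = 0) : (√(pilotVar p l k) : ℂ) * eveCorr p l =
      √(τ * p.ρE) * √(p.βE l) := by
    subst hk
    exact_mod_cast (hscale _).trans (Real.sqrt_mul (by positivity) _)
  have hN : (√(pilotVar p l k) : ℂ) * √(pilotVar p l k)⁻¹ = 1 := by
    exact_mod_cast (by simpa using hscale 1)
  ext m
  rw [hp.pilotMatrix_mulVec_apply]
  change _ = (√(pilotVar p l k) : ℂ) * (estRow p l k ⬝ᵥ antennaEntries r l m ω)
  rw [estRow, antennaEntries, sumElim_dotProduct_sumElim, sumElim_dotProduct_sumElim,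
    single_dotProduct, smul_dotProduct, smul_eq_mul]
  simp_rw [mul_add, ← mul_assoc, hg, hN]
  split_ifs with hk
  · simp only [dotProduct, Finset.univ_unique, Finset.sum_singleton, ← mul_assoc, hgE hk, add_assoc,
      one_mul]
  · simp [dotProduct]

lemma Params.Admissible.hhat_eq (k : Fin K) :
    hhat p r l k = fun ω => (√(γ p l k) : ℂ) • whitened p r l (some k) ω := by
  have hβ := (hp.β_pos l k).le
  have hρu := hp.ρu_pos
  have hscale : √(τ * p.ρu) * p.β l k / pilotVar p l k * √(pilotVar p l k) = √(γ p l k) := by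
    rw [γ, Real.sqrt_div (by positivity), Real.sqrt_mul (by positivity) (p.β l k ^ 2),
      Real.sqrt_sq hβ, div_mul, Real.div_sqrt]
  funext ω
  rw [hhat, hp.pilotMatrix_mulVec, smul_smul, ← Complex.ofReal_mul, hscale]

omit r in
lemma Params.Admissible.γ_pos (k : Fin K) : 0 < γ p l k := by
  have hτ : 0 < τ := by
    refine Nat.pos_of_ne_zero ?_
    rintro rfl
    simpa using hp.pilots 0 0
  have hβ := hp.β_pos l k
  have hρu := hp.ρu_pos
  have hv := hp.pilotVar_pos l k
  unfold γ
  positivity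

lemma Params.Admissible.γE_eq : γE p l = p.βE l * eveCorr p l ^ 2 := by
  have hβ := (hp.β_pos l 0).ne'
  have hρu := hp.ρu_pos.ne'
  have hv := (hp.pilotVar_pos l 0).ne'
  rw [γE, γ, hp.eveCorr_sq]
  field_simp

lemma Params.Admissible.γE_nonneg : 0 ≤ γE p l := by
  rw [hp.γE_eq]
  exact mul_nonneg (hp.βE_nonneg l) (sq_nonneg _)

lemma Params.Admissible.γE_le : γE p l ≤ p.βE l := by
  rw [hp.γE_eq]
  exact mul_le_of_le_one_right (hp.βE_nonneg l) (hp.eveCorr_sq_lt_one l).le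

lemma Params.Admissible.gE_eq (m : Fin M) (ω : Ω) :
    r.gE l m ω = eveCorr p l * whitened p r l (some 0) ω m +
      √(1 - eveCorr p l ^ 2) * whitened p r l none ω m := by
  have hne : (√(1 - eveCorr p l ^ 2) : ℂ) ≠ 0 := by
    exact_mod_cast (Real.sqrt_pos.2 (sub_pos.2 (hp.eveCorr_sq_lt_one l))).ne'
  change _ = eveCorr p l * (estRow p l 0 ⬝ᵥ antennaEntries r l m ω) +
    √(1 - eveCorr p l ^ 2) * (errRow p l ⬝ᵥ antennaEntries r l m ω)
  rw [errRow, smul_dotProduct, sub_dotProduct, single_dotProduct, smul_dotProduct,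
    Complex.ofReal_inv, smul_eq_mul, mul_inv_cancel_left₀ hne]
  simp [antennaEntries]

lemma Params.Admissible.hE_eq (ω : Ω) :
    hE p r l ω = (√(γE p l) : ℂ) • whitened p r l (some 0) ω +
      (√(p.βE l - γE p l) : ℂ) • whitened p r l none ω := by
  have hβE := hp.βE_nonneg l
  have hc : 0 ≤ eveCorr p l := Real.sqrt_nonneg _
  have hest : √(γE p l) = √(p.βE l) * eveCorr p l := by
    rw [hp.γE_eq, Real.sqrt_mul hβE, Real.sqrt_sq hc]
  have herr : √(p.βE l - γE p l) = √(p.βE l) * √(1 - eveCorr p l ^ 2) := by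
    rw [hp.γE_eq, ← Real.sqrt_mul hβE, mul_one_sub]
  ext m
  simp only [hE, hp.gE_eq r l m ω, hest, herr, Pi.add_apply, Pi.smul_apply, smul_eq_mul,
    Complex.ofReal_mul]
  ring

end Whitened

section Gains

variable {Ω : Type*} {L K M τ : ℕ} [NeZero K] {p : Params L K M τ} {r : Randomness Ω L K M τ}

lemma HS_eq_colMat (l : Fin L) (ω : Ω) :
    HS p r l ω = colMat fun i : p.S l => hhat p r l i ω := by
  ext m i
  simp [HS, selS, Hhat, colMat, Matrix.mul_apply]

variable [MeasurableSpace Ω] {P : Measure Ω}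

lemma w_eq_precoder_hhat (l : Fin L) (t : Fin K) :
    w P p r l t = precoder P (p.S l) t (hhat p r l) := by
  unfold w precoder
  split_ifs with ht
  · congr 1
    funext ω
    rw [vPZF, pinvS, HS_eq_colMat, ppzfVec_of_mem ht, pinv]
    congr 1
    ext i
    simp [Pi.single_apply, Subtype.ext_iff]
  · congr 1
    funext ω
    rw [vPMRT, projB, pinvS, HS_eq_colMat, ppzfVec_of_notMem ht, orthProj, pinv]

lemma Params.Admissible.w_eq_precoder_whitened (hp : p.Admissible) (l : Fin L) (t : Fin K) :
    w P p r l t = precoder P (p.S l) t fun k => whitened p r l (some k) := by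
  have hhat_eq : hhat p r l = fun k ω => (√(γ p l k) : ℂ) • whitened p r l (some k) ω :=
    funext fun k => hp.hhat_eq r l k
  rw [w_eq_precoder_hhat, hhat_eq]
  exact precoder_ofReal_smul (fun k => Real.sqrt_pos.2 (hp.γ_pos l k)) (p.S l) t _

/-- The gain from AP `l` to the eavesdropper of the symbol of user `t` at unit power. -/
def apGainE (P : Measure Ω) (p : Params L K M τ) (r : Randomness Ω L K M τ) (l : Fin L)
    (t : Fin K) (ω : Ω) : ℂ :=
  star (hE p r l ω) ⬝ᵥ w P p r l t ω

lemma Params.Admissible.apGainE_eq (hp : p.Admissible) (l : Fin L) (t : Fin K) :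
    apGainE P p r l t = fun ω =>
      star ((√(γE p l) : ℂ) • whitened p r l (some 0) ω +
        (√(p.βE l - γE p l) : ℂ) • whitened p r l none ω) ⬝ᵥ
      precoder P (p.S l) t (fun k => whitened p r l (some k)) ω := by
  funext ω
  rw [apGainE, hp.hE_eq, hp.w_eq_precoder_whitened]

variable (hp : p.Admissible) (hr : r.IsRayleigh P)
include hp hr

lemma memLp_two_apGainE (l : Fin L) (t : Fin K) : MemLp (apGainE P p r l t) 2 P := by
  rw [hp.apGainE_eq]
  exact (hp.isStdGaussianFamily_whitened hr l).memLp_two_star_add_smul_dotProduct_precoder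
    (hp.card_lt l) _ _ _ _

lemma integral_apGainE (l : Fin L) (t : Fin K) :
    ∫ ω, apGainE P p r l t ω ∂P =
      ((if t = 0 then √(((M : ℝ) - (p.S l).card) * γE p l) else 0 : ℝ) : ℂ) := by
  rw [hp.apGainE_eq, (hp.isStdGaussianFamily_whitened hr
    l).integral_star_add_smul_dotProduct_precoder (hp.card_lt l),
    Nat.cast_sub (hp.card_lt l).le, mul_comm ((M : ℝ) - _), Real.sqrt_mul (hp.γE_nonneg l)]

lemma integral_norm_sq_apGainE (l : Fin L) (t : Fin K) :
    ∫ ω, ‖apGainE P p r l t ω‖ ^ 2 ∂P =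
      (if t = 0 then ((M : ℝ) - (p.S l).card) * γE p l else 0) +
        (p.βE l - δ p l 0 * γE p l) := by
  rw [hp.apGainE_eq, (hp.isStdGaussianFamily_whitened hr
    l).integral_norm_sq_star_add_smul_dotProduct_precoder (hp.card_lt l),
    Nat.cast_sub (hp.card_lt l).le, Real.sq_sqrt (hp.γE_nonneg l),
    Real.sq_sqrt (sub_nonneg.2 (hp.γE_le l)), δ]
  split_ifs <;> ring

lemma iIndepFun_apGainE (t : Fin K) : iIndepFun (fun l => apGainE P p r l t) P := by
  let c (l : Fin L) : ℝ :=
    (√(∫ ω, sqNorm (ppzfVec (p.S l) t fun k => whitened p r l (some k) ω) ∂P))⁻¹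
  let F (l : Fin L) (x : Option (Fin K) × Fin M → ℂ) : ℂ :=
    star ((√(γE p l) : ℂ) • (fun m => x (some 0, m)) +
        (√(p.βE l - γE p l) : ℂ) • fun m => x (none, m)) ⬝ᵥ
      ((c l : ℂ) • ppzfVec (p.S l) t fun k m => x (some k, m))
  have hF (l : Fin L) : Measurable (F l) := by
    have hest : Measurable fun (x : Option (Fin K) × Fin M → ℂ) k m => x (some k, m) := by
      fun_prop
    have hvec := (measurable_ppzfVec (p.S l) t).comp hest
    refine Finset.measurable_fun_sum _ fun m _ => .mul ?_ ?_
    · simp only [Pi.star_apply, Pi.add_apply, Pi.smul_apply]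
      fun_prop
    · exact ((measurable_pi_apply m).comp hvec).const_mul _
  have hgain : (fun l => apGainE P p r l t) =
      fun l ω => F l fun a => whitened p r l a.1 ω a.2 :=
    funext fun l => hp.apGainE_eq l t
  rw [hgain]
  exact (hp.iIndepFun_whitened hr).comp F hF

lemma memLp_two_gainE (t : Fin K) : MemLp (gainE P p r t) 2 P :=
  memLp_finsetSum _ fun l _ => (memLp_two_apGainE hp hr l t).const_mul _

lemma integrable_norm_sq_gainE (t : Fin K) : Integrable (fun ω => ‖gainE P p r t ω‖ ^ 2) P :=
  (memLp_two_gainE hp hr t).integrable_norm_pow (by simp)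

lemma integral_norm_sq_gainE (t : Fin K) :
    ∫ ω, ‖gainE P p r t ω‖ ^ 2 ∂P =
      (if t = 0 then (∑ l, √(p.ρ l 0 * ((M : ℝ) - (p.S l).card) * γE p l)) ^ 2 else 0) +
        ∑ l, p.ρ l t * (p.βE l - δ p l 0 * γE p l) := by
  let mean (l : Fin L) : ℝ :=
    if t = 0 then √(p.ρ l 0 * ((M : ℝ) - (p.S l).card) * γE p l) else 0
  have hmean (l : Fin L) : ∫ ω, (√(p.ρ l t) : ℂ) * apGainE P p r l t ω ∂P = (mean l : ℂ) := by
    rw [integral_const_mul, integral_apGainE hp hr, ← Complex.ofReal_mul]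
    simp only [mean]
    split_ifs with ht
    · rw [ht, mul_assoc, Real.sqrt_mul (hp.ρ_nonneg l 0)]
    · rw [mul_zero]
  have hsq (l : Fin L) : ∫ ω, ‖(√(p.ρ l t) : ℂ) * apGainE P p r l t ω‖ ^ 2 ∂P =
      mean l ^ 2 + p.ρ l t * (p.βE l - δ p l 0 * γE p l) := by
    have hcard : 0 ≤ (M : ℝ) - (p.S l).card := sub_nonneg.2 (mod_cast (hp.card_lt l).le)
    simp_rw [norm_mul, mul_pow, Complex.norm_real, Real.norm_eq_abs, sq_abs,
      Real.sq_sqrt (hp.ρ_nonneg l t)]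
    rw [integral_const_mul, integral_norm_sq_apGainE hp hr, mul_add]
    simp only [mean]
    split_ifs with ht
    · rw [Real.sq_sqrt (mul_nonneg (mul_nonneg (hp.ρ_nonneg l 0) hcard) (hp.γE_nonneg l)), ht,
        mul_assoc (p.ρ l 0)]
    · ring
  have hind : Pairwise fun l l' => IndepFun (fun ω => (√(p.ρ l t) : ℂ) * apGainE P p r l t ω)
      (fun ω => (√(p.ρ l' t) : ℂ) * apGainE P p r l' t ω) P := fun l l' hl =>
    ((iIndepFun_apGainE hp hr t).indepFun hl).comp (measurable_const_mul _)
      (measurable_const_mul _)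
  refine (integral_norm_sq_sum_of_indepFun
    (fun l => (memLp_two_apGainE hp hr l t).const_mul _) hind).trans ?_
  simp_rw [hmean, hsq, ← Complex.ofReal_sum, Complex.norm_real, Real.norm_eq_abs, sq_abs,
    add_sub_cancel_left]
  congr 1
  simp only [mean]
  split_ifs <;> simp

end Gains

section Dispersion

variable {Ω : Type*} [MeasurableSpace Ω] {P : Measure Ω} {Z : Ω → ℝ}

lemma integrable_log_of_one_le (hZ : Integrable Z P) (h1 : ∀ᵐ ω ∂P, 1 ≤ Z ω) :
    Integrable (fun ω => Real.log (Z ω)) P := by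
  refine hZ.mono' (Real.measurable_log.comp_aemeasurable hZ.1.aemeasurable).aestronglyMeasurable ?_
  filter_upwards [h1] with ω hω
  rw [Real.norm_of_nonneg (Real.log_nonneg hω)]
  exact Real.log_le_self (zero_le_one.trans hω)

lemma logb_two_one_add_div {x y : ℝ} (hx : 0 ≤ x) (hy : 0 < y) :
    Real.logb 2 (1 + x / y) = (Real.log (x + y) - Real.log y) / Real.log 2 := by
  rw [Real.logb, one_add_div hy.ne', Real.log_div (by positivity) hy.ne', add_comm x]

section Ratio

variable {X Y : Ω → ℝ} (hX : Integrable X P) (hY : Integrable Y P) (hX0 : ∀ᵐ ω ∂P, 0 ≤ X ω)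
  (hY1 : ∀ᵐ ω ∂P, 1 ≤ Y ω)
include hX0 hY1

lemma logb_two_one_add_div_ae_eq : (fun ω => Real.logb 2 (1 + X ω / Y ω)) =ᵐ[P]
    fun ω => (Real.log (X ω + Y ω) - Real.log (Y ω)) / Real.log 2 := by
  filter_upwards [hX0, hY1] with ω hω hω1
  exact logb_two_one_add_div hω (one_pos.trans_le hω1)

lemma one_le_add_ae : ∀ᵐ ω ∂P, 1 ≤ X ω + Y ω := by
  filter_upwards [hX0, hY1] with ω hω hω1
  exact le_add_of_nonneg_of_le hω hω1

include hX hY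

lemma integrable_logb_two_one_add_div : Integrable (fun ω => Real.logb 2 (1 + X ω / Y ω)) P :=
  (((integrable_log_of_one_le (hX.add hY) (one_le_add_ae hX0 hY1)).sub
    (integrable_log_of_one_le hY hY1)).div_const _).congr
    (logb_two_one_add_div_ae_eq hX0 hY1).symm

end Ratio

variable [IsProbabilityMeasure P]

lemma one_le_integral (hZ : Integrable Z P) (h1 : ∀ᵐ ω ∂P, 1 ≤ Z ω) : 1 ≤ ∫ ω, Z ω ∂P := by
  simpa using integral_mono_ae (integrable_const (1 : ℝ)) hZ h1

lemma integral_log_le_log_integral (hZ : Integrable Z P) (h1 : ∀ᵐ ω ∂P, 1 ≤ Z ω) :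
    ∫ ω, Real.log (Z ω) ∂P ≤ Real.log (∫ ω, Z ω ∂P) := by
  have hpos : Set.Ici (1 : ℝ) ⊆ Set.Ioi 0 := Set.Ici_subset_Ioi.2 one_pos
  exact (strictConcaveOn_log_Ioi.concaveOn.subset hpos (convex_Ici 1)).le_map_integral
    (Real.continuousOn_log.mono fun x hx => (hpos hx).ne') isClosed_Ici h1 hZ
    (integrable_log_of_one_le hZ h1)

lemma integrable_inv_of_one_le (hZ : Integrable Z P) (h1 : ∀ᵐ ω ∂P, 1 ≤ Z ω) :
    Integrable (fun ω => (Z ω)⁻¹) P := by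
  refine (integrable_const (1 : ℝ)).mono' hZ.1.aemeasurable.inv.aestronglyMeasurable ?_
  filter_upwards [h1] with ω hω
  rw [norm_inv, Real.norm_of_nonneg (zero_le_one.trans hω)]
  exact inv_le_one_of_one_le₀ hω

lemma dispersion_eq_integral_mul_integral_inv_sub_one (hZ : Integrable Z P)
    (h1 : ∀ᵐ ω ∂P, 1 ≤ Z ω) :
    dispersion P Z = (∫ ω, Z ω ∂P) * ∫ ω, (Z ω)⁻¹ ∂P - 1 := by
  have hμ : ∫ ω, Z ω ∂P ≠ 0 := (one_pos.trans_le (one_le_integral hZ h1)).ne'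
  have hinv := integrable_inv_of_one_le hZ h1
  rw [dispersion]
  set μ := ∫ ω, Z ω ∂P with hμ_def
  have hexpand : (fun ω => (Z ω - μ) ^ 2 / (Z ω * μ)) =ᵐ[P]
      fun ω => Z ω / μ + μ * (Z ω)⁻¹ - 2 := by
    filter_upwards [h1] with ω hω
    have hω0 : Z ω ≠ 0 := (one_pos.trans_le hω).ne'
    field_simp
    ring
  have hsum : Integrable (fun ω => Z ω / μ + μ * (Z ω)⁻¹) P :=
    (hZ.div_const μ).add (hinv.const_mul μ)
  rw [integral_congr_ae hexpand, integral_sub hsum (integrable_const 2),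
    integral_add (hZ.div_const μ) (hinv.const_mul μ), integral_div, integral_const_mul, ← hμ_def,
    div_self hμ, integral_const, probReal_univ, one_smul]
  ring

lemma log_integral_sub_integral_log_le_dispersion (hZ : Integrable Z P)
    (h1 : ∀ᵐ ω ∂P, 1 ≤ Z ω) :
    Real.log (∫ ω, Z ω ∂P) - ∫ ω, Real.log (Z ω) ∂P ≤ dispersion P Z := by
  have hμ : 0 < ∫ ω, Z ω ∂P := one_pos.trans_le (one_le_integral hZ h1)
  have hlog := integrable_log_of_one_le hZ h1
  have hinv := (integrable_inv_of_one_le hZ h1).const_mul (∫ ω, Z ω ∂P)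
  have hmean : ∫ ω, (Real.log (∫ ω', Z ω' ∂P) - Real.log (Z ω)) ∂P ≤
      ∫ ω, ((∫ ω', Z ω' ∂P) * (Z ω)⁻¹ - 1) ∂P := by
    refine integral_mono_ae ((integrable_const _).sub hlog) (hinv.sub (integrable_const 1)) ?_
    filter_upwards [h1] with ω hω
    have hω0 : 0 < Z ω := one_pos.trans_le hω
    rw [← div_eq_mul_inv, ← Real.log_div hμ.ne' hω0.ne']
    exact Real.log_le_sub_one_of_pos (div_pos hμ hω0)
  rw [dispersion_eq_integral_mul_integral_inv_sub_one hZ h1]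
  simpa [integral_sub, hlog, hinv, integral_const_mul] using hmean

lemma abs_integral_logb_two_one_add_div_sub_le {X Y : Ω → ℝ} (hX : Integrable X P)
    (hY : Integrable Y P) (hX0 : ∀ᵐ ω ∂P, 0 ≤ X ω) (hY1 : ∀ᵐ ω ∂P, 1 ≤ Y ω) :
    |∫ ω, Real.logb 2 (1 + X ω / Y ω) ∂P - Real.logb 2 (1 + (∫ ω, X ω ∂P) / ∫ ω, Y ω ∂P)| ≤
      max (dispersion P fun ω => X ω + Y ω) (dispersion P Y) / Real.log 2 := by
  have hXY : Integrable (fun ω => X ω + Y ω) P := hX.add hY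
  have hXY1 := one_le_add_ae hX0 hY1
  have hsum_le := integral_log_le_log_integral hXY hXY1
  have hle_sum := log_integral_sub_integral_log_le_dispersion hXY hXY1
  have hY_le := integral_log_le_log_integral hY hY1
  have hle_Y := log_integral_sub_integral_log_le_dispersion hY hY1
  rw [integral_congr_ae (logb_two_one_add_div_ae_eq hX0 hY1), integral_div,
    integral_sub (integrable_log_of_one_le hXY hXY1) (integrable_log_of_one_le hY hY1),
    logb_two_one_add_div (integral_nonneg_of_ae hX0) (one_pos.trans_le (one_le_integral hY hY1)),
    ← integral_add hX hY, ← sub_div, abs_div, abs_of_pos (Real.log_pos one_lt_two)]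
  gcongr
  rw [abs_le]
  constructor
  · linarith [le_max_left (dispersion P fun ω => X ω + Y ω) (dispersion P Y)]
  · linarith [le_max_right (dispersion P fun ω => X ω + Y ω) (dispersion P Y)]

end Dispersion

section Rate

variable {Ω : Type*} [MeasurableSpace Ω] {P : Measure Ω} {L K M τ : ℕ} [NeZero K]

lemma zE_eq (p : Params L K M τ) (r : Randomness Ω L K M τ) (s : Fin K → ℂ) (n : ℂ) (ω : Ω) :
    zE P p r s n ω =
      gainE P p r 0 ω * s 0 + (∑ t with t ≠ 0, gainE P p r t ω * s t) + n := by
  have hsum : ∑ l, star (hE p r l ω) ⬝ᵥ transmit P p r s l ω = ∑ t, gainE P p r t ω * s t := by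
    simp only [transmit, gainE, dotProduct_sum, dotProduct_smul, smul_eq_mul, Finset.sum_mul]
    rw [Finset.sum_comm]
    exact Finset.sum_congr rfl fun t _ => Finset.sum_congr rfl fun l _ => mul_right_comm _ _ _
  rw [zE, hsum, Finset.filter_ne',
    Finset.add_sum_erase _ (fun t => gainE P p r t ω * s t) (Finset.mem_univ 0)]

lemma one_le_interfE (p : Params L K M τ) (r : Randomness Ω L K M τ) (ω : Ω) :
    1 ≤ interfE P p r ω :=
  le_add_of_nonneg_left (Finset.sum_nonneg fun _ _ => sq_nonneg _)

variable {p : Params L K M τ} {r : Randomness Ω L K M τ} (hp : p.Admissible)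
  (hr : r.IsRayleigh P)
include hp hr

lemma integral_norm_sq_gainE_zero : ∫ ω, ‖gainE P p r 0 ω‖ ^ 2 ∂P = sinrENum p := by
  rw [integral_norm_sq_gainE hp hr, if_pos rfl, sinrENum, servedPZF, Finset.sum_filter,
    add_sub_assoc, ← Finset.sum_sub_distrib]
  congr 1
  refine Finset.sum_congr rfl fun l _ => ?_
  rw [δ, mul_sub, ite_mul, one_mul, zero_mul, mul_ite, mul_zero]

lemma integral_norm_sq_gainE_of_ne_zero {t : Fin K} (ht : t ≠ 0) :
    ∫ ω, ‖gainE P p r t ω‖ ^ 2 ∂P = ∑ l, p.ρ l t * (p.βE l - δ p l 0 * γE p l) := by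
  rw [integral_norm_sq_gainE hp hr, if_neg ht, zero_add]

lemma approxRateE_eq : approxRateE P p r = Real.logb 2 (1 + sinrE p) := by
  rw [approxRateE, sinrE, integral_norm_sq_gainE_zero hp hr, Finset.sum_congr rfl fun t ht =>
    integral_norm_sq_gainE_of_ne_zero hp hr (Finset.mem_filter.1 ht).2]

lemma integrable_interfE : Integrable (interfE P p r) P := by
  have := hr.indep.isProbabilityMeasure
  exact (integrable_finsetSum _ fun t _ => integrable_norm_sq_gainE hp hr t).add
    (integrable_const 1)

lemma integral_interfE :
    ∫ ω, interfE P p r ω ∂P = ∑ t with t ≠ 0, ∫ ω, ‖gainE P p r t ω‖ ^ 2 ∂P + 1 := by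
  have := hr.indep.isProbabilityMeasure
  simp only [interfE]
  rw [integral_add (integrable_finsetSum _ fun t _ => integrable_norm_sq_gainE hp hr t)
    (integrable_const 1), integral_finsetSum _ fun t _ => integrable_norm_sq_gainE hp hr t,
    integral_const, probReal_univ, one_smul]

lemma integrable_instRateE : Integrable (instRateE P p r) P :=
  integrable_logb_two_one_add_div (integrable_norm_sq_gainE hp hr 0) (integrable_interfE hp hr)
    (.of_forall fun _ => sq_nonneg _) (.of_forall fun ω => one_le_interfE p r ω)

lemma abs_rateE_sub_approxRateE_le :
    |rateE P p r - approxRateE P p r| ≤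
      max (dispersion P fun ω => signalE P p r ω + interfE P p r ω)
        (dispersion P (interfE P p r)) / Real.log 2 := by
  have := hr.indep.isProbabilityMeasure
  have hbound := abs_integral_logb_two_one_add_div_sub_le (X := signalE P p r)
    (integrable_norm_sq_gainE hp hr 0) (integrable_interfE hp hr)
    (.of_forall fun _ => sq_nonneg _) (.of_forall fun ω => one_le_interfE p r ω)
  rwa [integral_interfE hp hr] at hbound

end Rate

end CellFree

end

theorem proposition2 {Ω : Type*} [MeasurableSpace Ω] (P : Measure Ω) [IsProbabilityMeasure P]
    {L K M τ : ℕ} [NeZero K] (p : CellFree.Params L K M τ) (hp : p.Admissible)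
    (r : CellFree.Randomness Ω L K M τ) (hr : r.IsRayleigh P) :
    -- the received signal: desired part, interference, noise
    (∀ (s : Fin K → ℂ) (n : ℂ) (ω : Ω), CellFree.zE P p r s n ω =
      CellFree.gainE P p r 0 ω * s 0 + (∑ t with t ≠ 0, CellFree.gainE P p r t ω * s t) + n) ∧
    -- second moment of the desired gain
    Integrable (fun ω => ‖CellFree.gainE P p r 0 ω‖ ^ 2) P ∧
    ∫ ω, ‖CellFree.gainE P p r 0 ω‖ ^ 2 ∂P =
      (∑ l, Real.sqrt (p.ρ l 0 * ((M : ℝ) - (p.S l).card) * CellFree.γE p l)) ^ 2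
        + ∑ l, p.ρ l 0 * p.βE l
        - ∑ l ∈ CellFree.servedPZF p 0, p.ρ l 0 * CellFree.γE p l ∧
    -- second moments of the interference gains
    (∀ t : Fin K, t ≠ 0 →
      Integrable (fun ω => ‖CellFree.gainE P p r t ω‖ ^ 2) P ∧
      ∫ ω, ‖CellFree.gainE P p r t ω‖ ^ 2 ∂P =
        ∑ l, p.ρ l t * (p.βE l - CellFree.δ p l 0 * CellFree.γE p l)) ∧
    -- the approximate spectral efficiency in closed form
    CellFree.approxRateE P p r = Real.logb 2 (1 + CellFree.sinrE p) ∧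
    -- the spectral efficiency itself, and the error of the approximation
    Integrable (CellFree.instRateE P p r) P ∧
    |CellFree.rateE P p r - Real.logb 2 (1 + CellFree.sinrE p)| ≤
      max (CellFree.dispersion P fun ω => CellFree.signalE P p r ω + CellFree.interfE P p r ω)
        (CellFree.dispersion P (CellFree.interfE P p r)) / Real.log 2 := by
  have happrox := CellFree.approxRateE_eq hp hr
  refine ⟨CellFree.zE_eq p r, CellFree.integrable_norm_sq_gainE hp hr 0,
    CellFree.integral_norm_sq_gainE_zero hp hr,
    fun t ht => ⟨CellFree.integrable_norm_sq_gainE hp hr t,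
      CellFree.integral_norm_sq_gainE_of_ne_zero hp hr ht⟩,
    happrox, CellFree.integrable_instRateE hp hr, ?_⟩
  rw [← happrox]
  exact CellFree.abs_rateE_sub_approxRateE_le hp hr
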